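/- Let $x=(x_1,x_2,\dots)$, $y=(y_1,y_2,\dots)$, and let $\mathcal B=\mathbb C[[x,y;p,p^{-1}]]$ be the completed bosonic Fock space, whose elements are the formal sums $\sum_{l\in\mathbb Z}v_l\,p^l$ with $v_l\in\mathbb C[[x,y]]$. The charged free bosons act on $\mathcal B$ (FMS bosonization) by the modes of the fields $$\varphi(z)=\sum_{i\in\mathbb Z}\varphi_i z^{-i-1}=p^{-1}\exp\Big(-\sum_{n>0}(x_n+y_n)z^n\Big)\exp\Big(\sum_{n>0}\big(\tfrac{\partial}{\partial x_n}-\tfrac{\partial}{\partial y_n}\big)\frac{z^{-n}}{n}\Big),$$ $$\varphi^*(z)=\sum_{i\in\mathbb Z}\varphi^*_i z^{-i}=p\exp\Big(\sum_{n>0}(x_n+y_n)z^n\Big)\Big(\sum_{k>0}kx_kz^{k-1}+\sum_{k>0}\tfrac{\partial}{\partial x_k}z^{-k-1}+p\tfrac{\partial}{\partial p}z^{-1}\Big)\exp\Big(-\sum_{n>0}\big(\tfrac{\partial}{\partial x_n}-\tfrac{\partial}{\partial y_n}\big)\frac{z^{-n}}{n}\Big).$$ Define $S_k(\pm(x+y))$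 by $\sum_{k\ge 0}S_k(\pm(x+y))w^k=\exp\big(\pm\sum_{n\ge1}(x_n+y_n)w^n\big)$, with $S_k(-x-y):=S_k(-(x+y))$ and $S_k=0$ for $k<0$. Let $s\ge 1$, $t\ge 0$ be integers and $a\in\mathbb C$. Put $$A_{s,t}=\sum_{m=0}^{t}S_m(x+y)\,S_{s+t-m}(-x-y),$$ for $n\ge 1$ define $f_i=f_i^{(n)}$ by the expansion $$\Big(\sum_{m=0}^{t}S_m(x+y)z^{-t-1+m}\Big)^n=\sum_{i=0}^{nt}f_i\,z^{-n(t+1)+i},$$ and set $$p_n=\sum_{i=0}^{nt}f_i\,\big(n(t+1)-i\big)\,x_{n(t+1)-i}.$$ Then $1-aA_{s,t}$ is invertible in $\mathbb C[[x,y]]$, the sum over $n$ below converges coefficientwise in $\mathbb C[[x,y]]$ to a series with zero constant term, the series $\exp(a\varphi_{-s}\varphi^*_{-t})\cdot 1=\sum_{k\ge0}\frac{1}{k!}(a\varphi_{-s}\varphi^*_{-t})^k\cdot 1$ converges coefficientwise in $\mathcal B$, and $$\exp\left(a\varphi_{-s}\varphi^*_{-t}\right)\cdot 1=\frac{1}{1-aA_{s,t}}\exp\left(-\sum_{n\ge1}\frac{p_n}{n}\left(\frac{-a\,S_{s-1}(-x-y)}{1-aA_{s,t}}\right)^n\right).$$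 Here coefficientwise convergence means that every monomial occurs in only finitely many terms. -/

import Mathlib

open scoped LaurentPolynomial Nat

noncomputable section

namespace ChargedBosons

/-- The ring `ℂ[[x, y]]` of formal power series in `x₁, x₂, …` (indexed by `Sum.inl`) and
`y₁, y₂, …` (indexed by `Sum.inr`). -/
abbrev R : Type := MvPowerSeries (ℕ+ ⊕ ℕ+) ℂ

/-- The variable `x_n`, for `n ≥ 1` (and `0` for `n = 0`, an index that is never used). -/
def x (n : ℕ) : R := if h : 0 < n then MvPowerSeries.X (Sum.inl ⟨n, h⟩) else 0

/-- The variable `y_n`, for `n ≥ 1` (and `0` for `n = 0`, an index that is never used). -/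
def y (n : ℕ) : R := if h : 0 < n then MvPowerSeries.X (Sum.inr ⟨n, h⟩) else 0

/-- The operator `∂/∂x_n` on `ℂ[[x, y]]`, for `n ≥ 1`. -/
def dx (n : ℕ) : Module.End ℂ R :=
  if h : 0 < n then (MvPowerSeries.pderiv ℂ (Sum.inl (⟨n, h⟩ : ℕ+))).toLinearMap else 0

/-- The operator `∂/∂y_n` on `ℂ[[x, y]]`, for `n ≥ 1`. -/
def dy (n : ℕ) : Module.End ℂ R :=
  if h : 0 < n then (MvPowerSeries.pderiv ℂ (Sum.inr (⟨n, h⟩ : ℕ+))).toLinearMap else 0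

/-- The elementary Schur polynomial `S_k(u)` in a sequence `u = (u₁, u₂, …)` of commuting elements
of a `ℂ`-algebra: the coefficient of `z^k` in `exp (∑_{n ≥ 1} u_n z^n)`, and `0` for `k < 0`
(`u 0` is ignored).  Powers `j > k` of the exponent do not contribute to the coefficient of `z^k`,
so that the exponential series may be cut off at `j = k`.  The algebra need not be commutative,
which allows the `u_n` to be commuting differential operators. -/
def schur {A : Type*} [Ring A] [Algebra ℂ A] (u : ℕ → A) (k : ℤ) : A :=
  if k < 0 then 0 else
    ∑ j ∈ Finset.range (k.toNat + 1),
      ((j ! : ℂ)⁻¹) • PowerSeries.coeff k.toNat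
        ((PowerSeries.mk fun n => if n = 0 then 0 else u n) ^ j)

/-- `S_k(x + y)`. -/
def Spos (k : ℤ) : R := schur (fun n => x n + y n) k

/-- `S_k(-x - y)`. -/
def Sneg (k : ℤ) : R := schur (fun n => -x n - y n) k

/-- The coefficient of `z^{-k}` in `exp (∑_{n ≥ 1} (∂x_n - ∂y_n) z^{-n} / n)`. -/
def Dpos (k : ℕ) : Module.End ℂ R := schur (fun n => (n : ℂ)⁻¹ • (dx n - dy n)) (k : ℤ)

/-- The coefficient of `z^{-k}` in `exp (-∑_{n ≥ 1} (∂x_n - ∂y_n) z^{-n} / n)`. -/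
def Dneg (k : ℕ) : Module.End ℂ R := schur (fun n => -((n : ℂ)⁻¹ • (dx n - dy n))) (k : ℤ)

/-- A family of formal power series is locally finite if every monomial occurs in only finitely
many of its members. -/
def LocallyFinite {ι : Type*} (F : ι → R) : Prop :=
  ∀ m, {i | MvPowerSeries.coeff m (F i) ≠ 0}.Finite

/-- The coefficientwise sum of a (locally finite) family of formal power series. -/
def formalSum {ι : Type*} (F : ι → R) : R := fun m => ∑ᶠ i, MvPowerSeries.coeff m (F i)

/-- The completed bosonic Fock space `ℂ[[x, y; p, p⁻¹]]`: the element `v` stands for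
`∑_{l ∈ ℤ} v_l p^l` with `v_l ∈ ℂ[[x, y]]`. -/
abbrev B : Type := ℤ → R

/-- `g ∈ ℂ[[x, y]]` as an element `g p^0` of the bosonic Fock space. -/
def ofR (g : R) : B := Pi.single 0 g

/-- The family `F` of elements of the bosonic Fock space is locally finite, with formal
(coefficientwise) sum `v`. -/
def HasFormalSum {ι : Type*} (F : ι → B) (v : B) : Prop :=
  ∀ l : ℤ, LocallyFinite (fun i => F i l) ∧ formalSum (fun i => F i l) = v l

/-- The Heisenberg operator `α_r` on `p^l ℂ[[x, y]]`: `α_r = ∂x_r` and `α_{-r} = r x_r` for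
`r > 0`, and `α_0 = p ∂/∂p` is multiplication by `l`. -/
def heis (l r : ℤ) (f : R) : R :=
  if 0 < r then dx r.toNat f
  else if r < 0 then ((-r : ℤ) : ℂ) • (x (-r).toNat * f)
  else (l : ℂ) • f

/-- The mode `φ_i` of the field
`φ(z) = ∑_i φ_i z^{-i-1}
      = p⁻¹ exp (-∑ (x_n + y_n) z^n) exp (∑ (∂x_n - ∂y_n) z^{-n} / n)`,
that is, its coefficient of `z^{-i-1}`.
The factor `S_j(-x - y) z^j` of the first exponential and the factor with `z^{-k}` of the second one
contribute if `j - k = -i - 1`.  The sum over `k` is locally finite, because every monomial of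
`S_j(-x - y)` has weight `j`, where `x_n` and `y_n` have weight `n`. -/
def phi (i : ℤ) (v : B) : B := fun l =>
  formalSum fun k : ℕ => Sneg (k - i - 1) * Dpos k (v (l + 1))

/-- The mode `φ*_i` of the field
`φ*(z) = ∑_i φ*_i z^{-i}
       = p exp (∑ (x_n + y_n) z^n) (∑_{k>0} k x_k z^{k-1} + ∑_{k>0} ∂x_k z^{-k-1} + p ∂_p z^{-1})
           exp (-∑ (∂x_n - ∂y_n) z^{-n} / n)`,
that is, its coefficient of `z^{-i}`.
The middle factor is `∑_{r ∈ ℤ} α_r z^{-r-1}`; the factors `S_j(x + y) z^j`, `α_r z^{-r-1}` and the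
one with `z^{-k}` contribute if `j - r - 1 - k = -i`.  The sum over `(r, k)` is locally finite:
the weight `j` of `S_j(x + y)` bounds `r + k` from above, and the weight of `x_{-r}` bounds
`r` from below. -/
def phiStar (i : ℤ) (v : B) : B := fun l =>
  formalSum fun q : ℤ × ℕ =>
    Spos (q.1 + 1 + q.2 - i) * heis (l - 1) q.1 (Dneg q.2 (v (l - 1)))

theorem schur_of_neg {A : Type*} [Ring A] [Algebra ℂ A] (u : ℕ → A) (k : ℤ) (h : k < 0) :
    schur u k = 0 := by simp [schur, h]

/-- The weight of a monomial, where `x_n` and `y_n` have weight `n`. -/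
def wt (m : (ℕ+ ⊕ ℕ+) →₀ ℕ) : ℕ := m.sum fun i e => e * Sum.elim (fun n : ℕ+ => (n:ℕ)) (fun n : ℕ+ => (n:ℕ)) i

theorem wt_add (m n) : wt (m+n) = wt m + wt n := by
  unfold wt; rw [Finsupp.sum_add_index'] <;> simp [add_mul]

/-- Every monomial of `f` has weight `w`. -/
def IsHom (f : R) (w : ℕ) : Prop := ∀ m, MvPowerSeries.coeff m f ≠ 0 → wt m = w

theorem IsHom.mul {f g : R} {a b} (hf : IsHom f a) (hg : IsHom g b) : IsHom (f*g) (a+b) := by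
  classical
  intro m h
  rw [MvPowerSeries.coeff_mul] at h
  obtain ⟨q, hq, h⟩ := Finset.exists_ne_zero_of_sum_ne_zero h
  rw [← Finset.HasAntidiagonal.mem_antidiagonal.1 hq, wt_add, hf _ (left_ne_zero_of_mul h), hg _ (right_ne_zero_of_mul h)]

theorem IsHom.sum {ι} {s : Finset ι} {f : ι → R} {a} (hf : ∀ i ∈ s, IsHom (f i) a) : IsHom (∑ i ∈ s, f i) a := by
  intro m h
  rw [map_sum] at h
  obtain ⟨q, hq, h⟩ := Finset.exists_ne_zero_of_sum_ne_zero h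
  exact hf q hq m h

theorem IsHom.schur {u : ℕ → R} (hu : ∀ n, 0 < n → IsHom (u n) n) (k : ℕ) : IsHom (schur u k) k := by
  have key : ∀ j k, IsHom (PowerSeries.coeff k ((PowerSeries.mk fun n => if n = 0 then 0 else u n) ^ j)) k := by
    intro j
    induction j with
    | zero =>
      classical
      intro k m h
      rw [pow_zero, PowerSeries.coeff_one] at h
      split_ifs at h with hk
      · rw [MvPowerSeries.coeff_one] at h
        split_ifs at h with hm
        · simp [hm, hk, wt]
        · simp at h
      · simp at h
    | succ j ih =>
      intro k
      rw [pow_succ, PowerSeries.coeff_mul]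
      refine IsHom.sum fun q hq => ?_
      rw [← Finset.HasAntidiagonal.mem_antidiagonal.1 hq]
      refine (ih _).mul ?_
      rw [PowerSeries.coeff_mk]
      split_ifs with h
      · intro m hm; simp at hm
      · exact hu _ (by omega)
  unfold ChargedBosons.schur
  rw [if_neg (by omega)]
  refine IsHom.sum fun j _ m h => ?_
  rw [map_smul] at h
  exact key j _ m (right_ne_zero_of_mul h)

theorem isHom_x (n) : IsHom (x n) n := by
  classical
  intro m hm
  unfold x at hm
  split_ifs at hm with h
  · rw [MvPowerSeries.coeff_X] at hm
    split_ifs at hm with h2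
    · simp [h2, wt]; rfl
    · simp at hm
  · simp at hm

theorem isHom_y (n) : IsHom (y n) n := by
  classical
  intro m hm
  unfold y at hm
  split_ifs at hm with h
  · rw [MvPowerSeries.coeff_X] at hm
    split_ifs at hm with h2
    · simp [h2, wt]; rfl
    · simp at hm
  · simp at hm

theorem IsHom.sub {f g : R} {a} (hf : IsHom f a) (hg : IsHom g a) : IsHom (f-g) a := by
  intro m h
  by_contra hh
  apply h
  rw [map_sub, not_not.1 (mt (hf m) hh), not_not.1 (mt (hg m) hh), sub_zero]

theorem IsHom.neg {f : R} {a} (hf : IsHom f a) : IsHom (-f) a := by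
  intro m h; exact hf m (by simpa using h)

theorem isHom_Sneg (k : ℕ) : IsHom (Sneg k) k := IsHom.schur (fun n _ => (isHom_x n).neg.sub (isHom_y n)) k

theorem isHom_Spos (k : ℕ) : IsHom (Spos k) k := IsHom.schur (fun n _ => by simpa using (isHom_x n).sub (isHom_y n).neg) k

theorem IsHom.weight_le {f g : R} {a : ℕ} (hf : IsHom f a) (m) (h : MvPowerSeries.coeff m (f*g) ≠ 0) : a ≤ wt m := by
  classical
  rw [MvPowerSeries.coeff_mul] at h
  obtain ⟨q, hq, h⟩ := Finset.exists_ne_zero_of_sum_ne_zero h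
  rw [← Finset.HasAntidiagonal.mem_antidiagonal.1 hq, wt_add, hf _ (left_ne_zero_of_mul h)]; omega

theorem weight_Sneg_le (k : ℤ) (g m) (h : MvPowerSeries.coeff m (Sneg k*g) ≠ 0) : 0 ≤ k ∧ k ≤ wt m := by
  by_cases hk : k < 0
  · simp [Sneg, schur_of_neg _ _ hk] at h
  · lift k to ℕ using (by omega)
    have := IsHom.weight_le (isHom_Sneg k) m h
    omega

theorem weight_Spos_le (k : ℤ) (g m) (h : MvPowerSeries.coeff m (Spos k*g) ≠ 0) : 0 ≤ k ∧ k ≤ wt m := by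
  by_cases hk : k < 0
  · simp [Spos, schur_of_neg _ _ hk] at h
  · lift k to ℕ using (by omega)
    have := IsHom.weight_le (isHom_Spos k) m h
    omega

/-- The sums that define the modes `φ_i` are locally finite. -/
theorem locallyFinite_phi (i l : ℤ) (v : B) : LocallyFinite fun k : ℕ => Sneg (k - i - 1) * Dpos k (v (l + 1)) := by
  intro m
  refine (Set.finite_le_nat (wt m + i + 1).toNat).subset fun k hk => ?_
  have := weight_Sneg_le _ _ _ hk
  simp only [Set.mem_ofPred_eq]; omega

/-- The sums that define the modes `φ*_i` are locally finite. -/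
theorem locallyFinite_phiStar (i l : ℤ) (v : B) : LocallyFinite fun q : ℤ × ℕ =>
    Spos (q.1 + 1 + q.2 - i) * heis (l - 1) q.1 (Dneg q.2 (v (l - 1))) := by
  intro m
  refine ((Set.finite_Icc (-(wt m:ℤ)) (wt m+i)).prod (Set.finite_le_nat (2*wt m + i + 1).toNat)).subset ?_
  rintro ⟨r, k⟩ hk
  have h1 := weight_Spos_le _ _ _ hk
  have h2 : -(wt m : ℤ) ≤ r := by
    by_contra hr
    have hr0 : r < 0 := by omega
    apply hr
    have hk' : MvPowerSeries.coeff m (x (-r).toNat * (((-r : ℤ):ℂ) • (Spos (r+1+k-i) * Dneg k (v (l-1))))) ≠ 0 := by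
      convert hk using 2
      simp only [heis, if_neg (show ¬ 0 < r by omega), if_pos hr0]
      simp only [mul_smul_comm]; congr 1; simp only [← mul_assoc, mul_comm]
    have := IsHom.weight_le (isHom_x _) m hk'
    omega
  simp only [Set.mem_prod, Set.mem_Icc, Set.mem_ofPred_eq] at *; omega

/-- `A_{s,t} = ∑_{m=0}^{t} S_m(x + y) S_{s+t-m}(-x - y)`. -/
def Acoef (s t : ℕ) : R :=
  ∑ m ∈ Finset.range (t + 1), Spos m * Sneg ((s : ℤ) + t - m)

/-- The coefficient `f_i` of `z^{-n(t+1)+i}` in `(∑_{m=0}^{t} S_m(x + y) z^{-t-1+m})^n`. -/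
def fcoef (t n i : ℕ) : R :=
  ((∑ m ∈ Finset.range (t + 1),
      LaurentPolynomial.C (Spos m) * LaurentPolynomial.T (-(t : ℤ) - 1 + m) : R[T;T⁻¹]) ^ n).coeff
    (-((n : ℤ) * (t + 1)) + i)

/-- `p_n = ∑_{i=0}^{nt} f_i (n(t+1) - i) x_{n(t+1)-i}`; the subtraction of natural numbers is exact,
as `i ≤ n t`. -/
def pcoef (t n : ℕ) : R :=
  ∑ i ∈ Finset.range (n * t + 1),
    fcoef t n i * (((n * (t + 1) - i : ℕ) : ℂ) • x (n * (t + 1) - i))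

/-- `-a S_{s-1}(-x - y) / (1 - a A_{s,t})`. -/
def wArg (a : ℂ) (s t : ℕ) : R :=
  -(a • Sneg ((s : ℤ) - 1)) * (1 - a • Acoef s t)⁻¹

/-- The terms `(p_n / n) (-a S_{s-1}(-x - y) / (1 - a A_{s,t}))^n`, `n ≥ 1`, of the exponent. -/
def expoTerm (a : ℂ) (s t : ℕ) (n : ℕ+) : R :=
  (((n : ℕ) : ℂ)⁻¹ • pcoef t n) * wArg a s t ^ (n : ℕ)

/-- The exponential `exp g` of a formal power series `g` with constant term `0`. -/
def expR (g : R) : R := (PowerSeries.exp ℂ).subst g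

end ChargedBosons

end

noncomputable section

namespace ChargedBosons

/-! Modes `φ_i` and `φ*_j` with `i + j < 0` commute (`phiR_phiStarR`). The cross terms of the two
orderings combine into convolutions of the `S_m(x+y)` with the `S_m(-x-y)` in positive total degree,
and these vanish because the two generating series are mutually inverse. Since `-s - t < 0`, the
`k`-th power of `φ_{-s} φ*_{-t}` on the vacuum is `φ_{-s}^k φ*_{-t}^k · 1`.

Put `τ = z⁻¹`, `Q(τ) = ∑_{m≤t} S_m(x+y) τ^{t+1-m}` and `T(ε) = ∑ T_k ε^k = exp(-∑ p_n ε^n/n)`. The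
functional `τ^N ↦ N x_N` sends `Q^n` to `p_n`. The exponentials of `±(∂x_n - ∂y_n)` are the shifts
`n x_n ↦ n x_n ± τ^n` that fix every `x_n + y_n`. They therefore send `p_n` to `p_n ± Q^n`, and
`T(ε)` to `T(ε)(1 - εQ)` or `T(ε)/(1 - εQ)` respectively (`mk_Gpos_Tcoef`, `mk_Gneg_Tcoef`).

The creation half: `φ*_{-t}` sends `T_k p^k` to `-(k+1) T_{k+1} p^{k+1}` (`phiStarR_Tcoef`). The
modes `≥ 0` of the Heisenberg field times the negative shift kill `T_k p^k` (`bracket_Gneg_Tcoef`).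
The remaining `t + 1` modes give `∑ p_{i+1} T_{k-i}`, which the logarithmic derivative of `T`
identifies.

The annihilation half: `φ_{-s}` multiplies `T(ε)` by `S_{s-1}(-x-y) - ε A_{s,t}`, so `φ_{-s}^k T_k`
is the coefficient of `ε^k` in `(S_{s-1} - εA)^k T(ε)` (`phiR_iterate_Tcoef`). Weighting by `(-a)^k`
and summing with the negative binomial series gives `∑_j T_j (-a S_{s-1})^j (1 - aA)^{-j-1}`, which
is the closed formula (`formalSum_expTerm`). All limits are taken in the filtration by weight. -/

/-! ### Elementary Schur polynomials and the Euler operator. -/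

theorem commute_powerSeries {A : Type*} [Ring A] {f g : PowerSeries A}
    (h : ∀ i j, Commute (PowerSeries.coeff i f) (PowerSeries.coeff j g)) : Commute f g := by
  ext n
  rw [PowerSeries.coeff_mul, PowerSeries.coeff_mul, ← Finset.Nat.sum_antidiagonal_swap]
  exact Finset.sum_congr rfl fun q _ => (h _ _)

/-- The exponent of the generating function of the elementary Schur polynomials. -/
def schurExp {A : Type*} [Ring A] (u : ℕ → A) : PowerSeries A :=
  PowerSeries.mk fun n => if n = 0 then 0 else u n

theorem coeff_schurExp_pow_eq_zero {A : Type*} [Ring A] (u : ℕ → A) {n j : ℕ} (h : n < j) :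
    PowerSeries.coeff n (schurExp u ^ j) = 0 := by
  induction j generalizing n with
  | zero => omega
  | succ j ih =>
    rw [pow_succ, PowerSeries.coeff_mul]
    refine Finset.sum_eq_zero fun q hq => ?_
    have := Finset.HasAntidiagonal.mem_antidiagonal.1 hq
    by_cases hq2 : q.2 = 0
    · simp [schurExp, hq2]
    · rw [ih (by omega), zero_mul]

section Schur

variable {A : Type*} [Ring A] [Algebra ℂ A]

/-- The Euler operator `z d/dz` on power series over a possibly noncommutative algebra. -/
def eulerPS (f : PowerSeries A) : PowerSeries A :=
  PowerSeries.mk fun n => (n : ℂ) • PowerSeries.coeff n f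

theorem eulerPS_mul (f g : PowerSeries A) :
    eulerPS (f * g) = eulerPS f * g + f * eulerPS g := by
  ext n
  simp only [eulerPS, PowerSeries.coeff_mk, PowerSeries.coeff_mul, map_add, Finset.smul_sum,
    ← Finset.sum_add_distrib]
  refine Finset.sum_congr rfl fun q hq => ?_
  rw [← Finset.HasAntidiagonal.mem_antidiagonal.1 hq, smul_mul_assoc, mul_smul_comm, ← add_smul]
  push_cast; rfl

theorem eulerPS_pow_succ {f : PowerSeries A} (h : Commute (eulerPS f) f) (j : ℕ) :
    eulerPS (f ^ (j + 1)) = ((j + 1 : ℕ) : ℂ) • (eulerPS f * f ^ j) := by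
  induction j with
  | zero => simp
  | succ j ih =>
    rw [pow_succ, eulerPS_mul, ih, smul_mul_assoc, mul_assoc, ← pow_succ,
      ← (h.pow_right (j + 1)).eq]
    push_cast
    module

theorem schur_natCast (u : ℕ → A) {n N : ℕ} (h : n ≤ N) : schur u n =
    ∑ j ∈ Finset.range (N + 1), ((j ! : ℂ)⁻¹) • PowerSeries.coeff n (schurExp u ^ j) := by
  rw [schur, if_neg (by omega)]
  refine Finset.sum_subset (Finset.range_mono (by omega)) fun j _ hj => ?_
  rw [Finset.mem_range] at hj
  have := coeff_schurExp_pow_eq_zero u (n := n) (j := j) (by simpa using hj)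
  simp only [Int.toNat_natCast]
  rw [schurExp] at this
  rw [this, smul_zero]

@[simp]
theorem schur_zero (u : ℕ → A) : schur u 0 = 1 := by simp [schur]

/-- Coefficient comparison in `z F' = (z U') F` for `F = exp U`. The integer index and the free
cutoff `N` allow shifted indices `n - r` without case distinctions. -/
theorem schur_recursion {u : ℕ → A} (hu : ∀ i j, Commute (u i) (u j)) (n : ℤ) (N : ℕ)
    (hN : n ≤ N) : (n : ℂ) • schur u n =
      ∑ i ∈ Finset.range N, ((i + 1 : ℕ) : ℂ) • (u (i + 1) * schur u (n - (i + 1))) := by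
  rcases lt_trichotomy n 0 with h | rfl | h
  · rw [schur_of_neg _ _ h, smul_zero, Finset.sum_eq_zero]
    intro i _
    rw [schur_of_neg _ _ (by omega), mul_zero, smul_zero]
  · rw [Int.cast_zero, zero_smul, Finset.sum_eq_zero]
    intro i _
    rw [schur_of_neg _ _ (by omega), mul_zero, smul_zero]
  obtain ⟨n, rfl⟩ : ∃ k : ℕ, n = k + 1 := ⟨(n - 1).toNat, by omega⟩
  -- Over a noncommutative algebra the power rule for `U^j` needs `U` to commute with `z U'`.
  have hc : Commute (eulerPS (schurExp u)) (schurExp u) := by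
    refine commute_powerSeries fun i j => ?_
    simp only [eulerPS, schurExp, PowerSeries.coeff_mk]
    refine Commute.smul_left ?_ _
    split_ifs
    · exact Commute.zero_left _
    · exact Commute.zero_left _
    · exact Commute.zero_right _
    · exact hu _ _
  have key (j : ℕ) : ((n + 1 : ℕ) : ℂ) • PowerSeries.coeff (n + 1) (schurExp u ^ (j + 1)) =
      ((j + 1 : ℕ) : ℂ) • ∑ i ∈ Finset.range (n + 1), ((i + 1 : ℕ) : ℂ) •
        (u (i + 1) * PowerSeries.coeff (n - i) (schurExp u ^ j)) := by
    have := congrArg (PowerSeries.coeff (n + 1)) (eulerPS_pow_succ hc j)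
    rw [eulerPS, PowerSeries.coeff_mk] at this
    rw [this, PowerSeries.coeff_smul, PowerSeries.coeff_mul,
      Finset.Nat.sum_antidiagonal_eq_sum_range_succ_mk, Finset.sum_range_succ']
    simp [eulerPS, schurExp]
  have h1 : schur u ((n : ℤ) + 1) = ∑ j ∈ Finset.range (n + 1),
      (((j + 1)! : ℂ)⁻¹) • PowerSeries.coeff (n + 1) (schurExp u ^ (j + 1)) := by
    have := schur_natCast u (le_refl (n + 1))
    push_cast at this
    rw [this, Finset.sum_range_succ']
    simp [PowerSeries.coeff_one]
  have h2 : ∑ i ∈ Finset.range N, ((i + 1 : ℕ) : ℂ) •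
        (u (i + 1) * schur u ((n + 1 : ℤ) - (i + 1))) =
      ∑ i ∈ Finset.range (n + 1), ((i + 1 : ℕ) : ℂ) • (u (i + 1) * schur u ((n - i : ℕ) : ℤ)) := by
    rw [← Finset.sum_subset (Finset.range_mono (show n + 1 ≤ N by omega))]
    · refine Finset.sum_congr rfl fun i hi => ?_
      rw [Finset.mem_range] at hi
      congr 3; omega
    · intro i _ hi
      rw [Finset.mem_range] at hi
      rw [schur_of_neg _ _ (by omega), mul_zero, smul_zero]
  rw [h1, h2, Finset.smul_sum]
  have h3 (j : ℕ) : (((n : ℤ) + 1 : ℤ) : ℂ) • (((j + 1)! : ℂ)⁻¹) •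
      PowerSeries.coeff (n + 1) (schurExp u ^ (j + 1)) =
      ∑ i ∈ Finset.range (n + 1), ((j ! : ℂ)⁻¹) • ((i + 1 : ℕ) : ℂ) •
        (u (i + 1) * PowerSeries.coeff (n - i) (schurExp u ^ j)) := by
    have hk := key j
    push_cast at hk ⊢
    rw [smul_comm, hk, smul_smul, Finset.smul_sum]
    refine Finset.sum_congr rfl fun i _ => ?_
    congr 1
    have : ((j : ℂ) + 1) ≠ 0 := by exact_mod_cast Nat.succ_ne_zero j
    have h' : (j ! : ℂ) ≠ 0 := by exact_mod_cast Nat.factorial_ne_zero j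
    rw [Nat.factorial_succ]; push_cast; field_simp
  simp_rw [h3]
  rw [Finset.sum_comm]
  refine Finset.sum_congr rfl fun i hi => ?_
  rw [schur_natCast u (show n - i ≤ n by omega), Finset.mul_sum, Finset.smul_sum]
  refine Finset.sum_congr rfl fun j _ => ?_
  rw [mul_smul_comm, smul_comm]

theorem commute_schur {u : ℕ → A} {b : A} (h : ∀ i, Commute b (u (i + 1))) (k : ℤ) :
    Commute b (schur u k) := by
  rw [schur]
  split_ifs
  · exact Commute.zero_right _
  refine Commute.sum_right _ _ _ fun j _ => Commute.smul_right ?_ _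
  have key : ∀ n, Commute b (PowerSeries.coeff n (schurExp u ^ j)) := by
    clear * - h
    induction j with
    | zero =>
      intro n
      rw [pow_zero, PowerSeries.coeff_one]
      split_ifs
      exacts [Commute.one_right _, Commute.zero_right _]
    | succ j ih =>
      intro n
      rw [pow_succ, PowerSeries.coeff_mul]
      refine Commute.sum_right _ _ _ fun q _ => (ih q.1).mul_right ?_
      rw [schurExp, PowerSeries.coeff_mk]
      split_ifs with hq
      · exact Commute.zero_right _
      · obtain ⟨i, hi⟩ := Nat.exists_eq_succ_of_ne_zero hq
        rw [hi]; exact h i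
  exact key _

theorem schur_induction {u : ℕ → A} (hu : ∀ i j, Commute (u i) (u j)) {P : ℤ → A → Prop}
    (h0 : P 0 1) (hneg : ∀ n < 0, P n 0)
    (hstep : ∀ n : ℕ, (∀ m : ℤ, m < n + 1 → P m (schur u m)) →
      P (n + 1) (((n + 1 : ℂ)⁻¹) • ∑ i ∈ Finset.range (n + 1),
        ((i + 1 : ℕ) : ℂ) • (u (i + 1) * schur u (n - i)))) (k : ℤ) : P k (schur u k) := by
  rcases lt_or_ge k 0 with h | h
  · rw [schur_of_neg _ _ h]; exact hneg _ h
  lift k to ℕ using h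
  induction k using Nat.strong_induction_on with
  | _ n ih =>
    cases n with
    | zero => simpa using h0
    | succ n =>
      have := hstep n fun m hm => by
        rcases lt_or_ge m 0 with h | h
        · rw [schur_of_neg _ _ h]; exact hneg _ h
        · lift m to ℕ using h
          exact ih m (by omega)
      push_cast
      convert this using 1
      have hne : ((n : ℂ) + 1) ≠ 0 := by exact_mod_cast Nat.succ_ne_zero n
      rw [eq_inv_smul_iff₀ hne]
      have := schur_recursion hu ((n + 1 : ℕ) : ℤ) (n + 1) le_rfl
      push_cast at this
      rw [this]
      refine Finset.sum_congr rfl fun i _ => ?_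
      rw [add_sub_add_right_eq_sub]; push_cast; rfl

end Schur

/-- A derivation `d` with `dU = c z^r` acts on `exp U` as multiplication by `c z^r`. This serves
both for derivatives of Schur polynomials and, with `d` a commutator, for moving the shift operators
past a variable. -/
theorem schur_leibniz {A : Type*} [Ring A] [Algebra ℂ A] {u : ℕ → A}
    (hu : ∀ i j, Commute (u i) (u j)) (d : A →ₗ[ℂ] A)
    (hd : ∀ a b, d (a * b) = a * d b + d a * b) {r : ℕ} (hr : 0 < r) {c : ℂ}
    (hc : ∀ i, d (u (i + 1)) = if i + 1 = r then c • 1 else 0) (k : ℤ) :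
    d (schur u k) = c • schur u (k - r) := by
  have h1 : d 1 = 0 := by simpa using hd 1 1
  refine schur_induction hu (P := fun k S => d S = c • schur u (k - r)) ?_ ?_ ?_ k
  · rw [h1, schur_of_neg _ _ (by omega), smul_zero]
  · intro n hn
    rw [map_zero, schur_of_neg _ _ (by omega), smul_zero]
  intro n ih
  have hne : ((n : ℂ) + 1) ≠ 0 := by exact_mod_cast Nat.succ_ne_zero n
  rw [map_smul, inv_smul_eq_iff₀ hne, map_sum]
  have hterm : ∀ i ∈ Finset.range (n + 1),
      d (((i + 1 : ℕ) : ℂ) • (u (i + 1) * schur u (n - i))) =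
      c • (((i + 1 : ℕ) : ℂ) • (u (i + 1) * schur u ((n + 1 - r : ℤ) - (i + 1)))) +
        if i + 1 = r then (c * r) • schur u (n + 1 - r) else 0 := by
    intro i hi
    rw [map_smul, hd, ih _ (by omega), hc, mul_smul_comm, smul_add, smul_comm c]
    congr 1
    · rw [show (n : ℤ) - i - r = (n + 1 - r : ℤ) - (i + 1) by ring]
    · split_ifs with h
      · subst h
        rw [smul_mul_assoc, one_mul, smul_smul, mul_comm c]
        congr 2; push_cast; ring
      · simp
  rw [Finset.sum_congr rfl hterm, Finset.sum_add_distrib, ← Finset.smul_sum,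
    ← schur_recursion hu _ (n + 1) (by push_cast; omega)]
  have hs : ∑ i ∈ Finset.range (n + 1),
      (if i + 1 = r then (c * r) • schur u ((n : ℤ) + 1 - r) else 0) =
      (c * r) • schur u ((n : ℤ) + 1 - r) := by
    obtain ⟨r, rfl⟩ := Nat.exists_eq_succ_of_ne_zero hr.ne'
    -- If no index of the sum matches, the right-hand side vanishes as well, since its Schur index
    -- is negative.
    by_cases h : r < n + 1
    · simp [h, Finset.sum_ite_eq']
    · rw [schur_of_neg _ _ (by push_cast; omega)]; simp
  rw [hs]
  push_cast
  module

theorem eulerPS_schur {A : Type*} [Ring A] [Algebra ℂ A] {u : ℕ → A}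
    (hu : ∀ i j, Commute (u i) (u j)) :
    eulerPS (PowerSeries.mk fun n : ℕ => schur u n) =
      eulerPS (schurExp u) * PowerSeries.mk fun n : ℕ => schur u n := by
  ext n
  rw [eulerPS, PowerSeries.coeff_mk, PowerSeries.coeff_mk, PowerSeries.coeff_mul,
    Finset.Nat.sum_antidiagonal_eq_sum_range_succ_mk, Finset.sum_range_succ']
  have := schur_recursion hu n n le_rfl
  rw [Int.cast_natCast] at this
  rw [this]
  simp only [eulerPS, schurExp, PowerSeries.coeff_mk]
  rw [Nat.cast_zero, zero_smul, zero_mul, add_zero]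
  refine Finset.sum_congr rfl fun i hi => ?_
  rw [Finset.mem_range] at hi
  rw [if_neg (by omega), smul_mul_assoc, Nat.cast_sub (by omega)]
  push_cast; rfl

/-- The logarithmic derivatives of the two exponentials cancel, so the Euler operator kills their
product and only the constant term survives. -/
theorem schur_mul_schur_neg {A : Type*} [CommRing A] [Algebra ℂ A] (u v : ℕ → A)
    (huv : ∀ i, v i = -u i) {n : ℕ} (hn : 0 < n) :
    ∑ i ∈ Finset.range (n + 1), schur u i * schur v ((n : ℤ) - i) = 0 := by
  set F : PowerSeries A := PowerSeries.mk fun n : ℕ => schur u n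
  set G : PowerSeries A := PowerSeries.mk fun n : ℕ => schur v n
  have hE : eulerPS (schurExp v) = -eulerPS (schurExp u) := by
    ext m
    simp only [eulerPS, schurExp, PowerSeries.coeff_mk, map_neg, huv]
    split_ifs <;> simp
  have h : eulerPS (F * G) = 0 := by
    rw [eulerPS_mul, eulerPS_schur fun _ _ => Commute.all _ _,
      eulerPS_schur fun _ _ => Commute.all _ _, hE]
    ring
  have h2 := congrArg (PowerSeries.coeff n) h
  rw [eulerPS, PowerSeries.coeff_mk, map_zero] at h2
  have h3 := (smul_eq_zero_iff_right (show (n : ℂ) ≠ 0 by exact_mod_cast hn.ne')).1 h2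
  rw [PowerSeries.coeff_mul, Finset.Nat.sum_antidiagonal_eq_sum_range_succ_mk] at h3
  rw [← h3]
  refine Finset.sum_congr rfl fun i hi => ?_
  rw [Finset.mem_range] at hi
  simp only [F, G, PowerSeries.coeff_mk]
  rw [Nat.cast_sub (by omega)]

/-! ### Partial derivatives of the variables and of the Schur polynomials. -/

/-- The index of the variable `x_n`. -/
def ix {n : ℕ} (h : 0 < n) : ℕ+ ⊕ ℕ+ := Sum.inl ⟨n, h⟩

/-- The index of the variable `y_n`. -/
def iy {n : ℕ} (h : 0 < n) : ℕ+ ⊕ ℕ+ := Sum.inr ⟨n, h⟩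

theorem ix_inj {m n : ℕ} {hm : 0 < m} {hn : 0 < n} : ix hm = ix hn ↔ m = n :=
  ⟨fun h => congrArg PNat.val (Sum.inl.inj h), fun h => by subst h; rfl⟩

theorem iy_inj {m n : ℕ} {hm : 0 < m} {hn : 0 < n} : iy hm = iy hn ↔ m = n :=
  ⟨fun h => congrArg PNat.val (Sum.inr.inj h), fun h => by subst h; rfl⟩

theorem dx_of_pos {n : ℕ} (h : 0 < n) : dx n = (MvPowerSeries.pderiv ℂ (ix h)).toLinearMap :=
  dif_pos h

theorem dy_of_pos {n : ℕ} (h : 0 < n) : dy n = (MvPowerSeries.pderiv ℂ (iy h)).toLinearMap :=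
  dif_pos h

theorem dx_zero : dx 0 = 0 := dif_neg (lt_irrefl 0)

theorem dy_zero : dy 0 = 0 := dif_neg (lt_irrefl 0)

theorem x_of_pos {n : ℕ} (h : 0 < n) : x n = MvPowerSeries.X (ix h) := dif_pos h

theorem y_of_pos {n : ℕ} (h : 0 < n) : y n = MvPowerSeries.X (iy h) := dif_pos h

theorem x_zero : x 0 = 0 := dif_neg (lt_irrefl 0)

theorem y_zero : y 0 = 0 := dif_neg (lt_irrefl 0)

theorem dx_mul (n : ℕ) (f g : R) : dx n (f * g) = f * dx n g + dx n f * g := by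
  rcases Nat.eq_zero_or_pos n with rfl | h
  · simp [dx_zero]
  · rw [dx_of_pos h]
    exact ((MvPowerSeries.pderiv ℂ (ix h)).leibniz f g).trans (by simp [mul_comm])

theorem dy_mul (n : ℕ) (f g : R) : dy n (f * g) = f * dy n g + dy n f * g := by
  rcases Nat.eq_zero_or_pos n with rfl | h
  · simp [dy_zero]
  · rw [dy_of_pos h]
    exact ((MvPowerSeries.pderiv ℂ (iy h)).leibniz f g).trans (by simp [mul_comm])

theorem commute_pderiv (i j : ℕ+ ⊕ ℕ+) :
    Commute (MvPowerSeries.pderiv ℂ i).toLinearMap (MvPowerSeries.pderiv ℂ j).toLinearMap := by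
  refine LinearMap.ext fun f => ?_
  change MvPowerSeries.pderiv ℂ i (MvPowerSeries.pderiv ℂ j f) =
    MvPowerSeries.pderiv ℂ j (MvPowerSeries.pderiv ℂ i f)
  by_cases hij : i = j
  · rw [hij]
  ext m
  simp only [MvPowerSeries.coeff_pderiv, Finsupp.add_apply, Finsupp.single_eq_of_ne hij,
    Finsupp.single_eq_of_ne (Ne.symm hij), add_zero]
  rw [add_right_comm]
  ring

theorem commute_dx_dx (m n : ℕ) : Commute (dx m) (dx n) := by
  rcases Nat.eq_zero_or_pos m with rfl | hm
  · rw [dx_zero]; exact Commute.zero_left _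
  rcases Nat.eq_zero_or_pos n with rfl | hn
  · rw [dx_zero]; exact Commute.zero_right _
  rw [dx_of_pos hm, dx_of_pos hn]
  exact commute_pderiv _ _

theorem commute_dx_dy (m n : ℕ) : Commute (dx m) (dy n) := by
  rcases Nat.eq_zero_or_pos m with rfl | hm
  · rw [dx_zero]; exact Commute.zero_left _
  rcases Nat.eq_zero_or_pos n with rfl | hn
  · rw [dy_zero]; exact Commute.zero_right _
  rw [dx_of_pos hm, dy_of_pos hn]
  exact commute_pderiv _ _

theorem commute_dy_dy (m n : ℕ) : Commute (dy m) (dy n) := by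
  rcases Nat.eq_zero_or_pos m with rfl | hm
  · rw [dy_zero]; exact Commute.zero_left _
  rcases Nat.eq_zero_or_pos n with rfl | hn
  · rw [dy_zero]; exact Commute.zero_right _
  rw [dy_of_pos hm, dy_of_pos hn]
  exact commute_pderiv _ _

theorem dx_x {m n : ℕ} (hm : 0 < m) (hn : 0 < n) : dx m (x n) = if n = m then 1 else 0 := by
  rw [dx_of_pos hm, x_of_pos hn]
  by_cases h : n = m
  · subst h
    rw [if_pos rfl]
    exact MvPowerSeries.pderiv_X_self
  · rw [if_neg h]
    exact MvPowerSeries.pderiv_X_of_ne fun h' => h (ix_inj.1 h')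

theorem dx_y (m n : ℕ) : dx m (y n) = 0 := by
  rcases Nat.eq_zero_or_pos m with rfl | hm
  · rw [dx_zero]; rfl
  rcases Nat.eq_zero_or_pos n with rfl | hn
  · rw [y_zero, map_zero]
  rw [dx_of_pos hm, y_of_pos hn]
  exact MvPowerSeries.pderiv_X_of_ne (by simp [ix, iy])

theorem dy_x (m n : ℕ) : dy m (x n) = 0 := by
  rcases Nat.eq_zero_or_pos m with rfl | hm
  · rw [dy_zero]; rfl
  rcases Nat.eq_zero_or_pos n with rfl | hn
  · rw [x_zero, map_zero]
  rw [dy_of_pos hm, x_of_pos hn]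
  exact MvPowerSeries.pderiv_X_of_ne (by simp [ix, iy])

theorem dy_y {m n : ℕ} (hm : 0 < m) (hn : 0 < n) : dy m (y n) = if n = m then 1 else 0 := by
  rw [dy_of_pos hm, y_of_pos hn]
  by_cases h : n = m
  · subst h
    rw [if_pos rfl]
    exact MvPowerSeries.pderiv_X_self
  · rw [if_neg h]
    exact MvPowerSeries.pderiv_X_of_ne fun h' => h (iy_inj.1 h')

/-- The derivation `∂x_n - ∂y_n`. -/
def dxy (n : ℕ) : Module.End ℂ R := dx n - dy n

theorem dxy_mul (n : ℕ) (f g : R) : dxy n (f * g) = f * dxy n g + dxy n f * g := by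
  simp only [dxy, LinearMap.sub_apply, dx_mul, dy_mul]; ring

theorem commute_dxy (m n : ℕ) : Commute (dxy m) (dxy n) :=
  ((commute_dx_dx m n).sub_right (commute_dx_dy m n)).sub_left
    ((commute_dx_dy n m).symm.sub_right (commute_dy_dy m n))

theorem commute_dx_dxy (m n : ℕ) : Commute (dx m) (dxy n) :=
  (commute_dx_dx m n).sub_right (commute_dx_dy m n)

theorem commute_all_R (u : ℕ → R) (i j : ℕ) : Commute (u i) (u j) := Commute.all _ _

theorem dx_Spos {r : ℕ} (hr : 0 < r) (k : ℤ) : dx r (Spos k) = Spos (k - r) := by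
  refine (schur_leibniz (commute_all_R _) (dx r) (dx_mul r) hr (c := 1) (fun i => ?_) k).trans
    (one_smul _ _)
  rw [map_add, dx_y, dx_x hr (by omega), add_zero, one_smul]

theorem dx_Sneg {r : ℕ} (hr : 0 < r) (k : ℤ) : dx r (Sneg k) = -Sneg (k - r) := by
  refine (schur_leibniz (commute_all_R _) (dx r) (dx_mul r) hr (c := -1) (fun i => ?_) k).trans
    (by rw [neg_one_smul]; rfl)
  rw [map_sub, map_neg, dx_y, dx_x hr (by omega)]
  split_ifs <;> simp

theorem dxy_zero : dxy 0 = 0 := by simp [dxy, dx_zero, dy_zero]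

theorem dxy_Spos (r : ℕ) (k : ℤ) : dxy r (Spos k) = 0 := by
  rcases Nat.eq_zero_or_pos r with rfl | hr
  · simp [dxy_zero]
  refine (schur_leibniz (commute_all_R _) (dxy r) (dxy_mul r) hr (c := 0) (fun i => ?_) k).trans
    (zero_smul _ _)
  simp only [dxy, LinearMap.sub_apply, map_add, dx_y, dy_x, dx_x hr (Nat.succ_pos i),
    dy_y hr (Nat.succ_pos i)]
  split_ifs <;> simp

theorem dxy_Sneg (r : ℕ) (k : ℤ) : dxy r (Sneg k) = 0 := by
  rcases Nat.eq_zero_or_pos r with rfl | hr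
  · simp [dxy_zero]
  refine (schur_leibniz (commute_all_R _) (dxy r) (dxy_mul r) hr (c := 0) (fun i => ?_) k).trans
    (zero_smul _ _)
  simp only [dxy, LinearMap.sub_apply, map_sub, map_neg, dx_y, dy_x, dx_x hr (Nat.succ_pos i),
    dy_y hr (Nat.succ_pos i)]
  split_ifs <;> simp

theorem dxy_x {m n : ℕ} (hm : 0 < m) (hn : 0 < n) : dxy m (x n) = if n = m then 1 else 0 := by
  simp [dxy, dx_x hm hn, dy_x]

theorem Spos_of_neg {k : ℤ} (h : k < 0) : Spos k = 0 := schur_of_neg _ _ h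

theorem Sneg_of_neg {k : ℤ} (h : k < 0) : Sneg k = 0 := schur_of_neg _ _ h

theorem Spos_zero : Spos 0 = 1 := schur_zero _

theorem sum_Spos_mul_Sneg {n : ℕ} (hn : 0 < n) :
    ∑ i ∈ Finset.range (n + 1), Spos i * Sneg ((n : ℤ) - i) = 0 :=
  schur_mul_schur_neg _ _ (fun i => by ring) hn

/-! ### The shift operators and their commutation with multiplications. -/

/-- `Dpos` with an integer index. -/
def DposZ (k : ℤ) : Module.End ℂ R := schur (fun n => (n : ℂ)⁻¹ • dxy n) k

/-- `Dneg` with an integer index. -/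
def DnegZ (k : ℤ) : Module.End ℂ R := schur (fun n => -((n : ℂ)⁻¹ • dxy n)) k

theorem Dpos_eq (k : ℕ) : Dpos k = DposZ k := rfl

theorem DposZ_of_neg {k : ℤ} (h : k < 0) : DposZ k = 0 := schur_of_neg _ _ h

theorem DnegZ_of_neg {k : ℤ} (h : k < 0) : DnegZ k = 0 := schur_of_neg _ _ h

theorem commute_DposZ {b : Module.End ℂ R} (h : ∀ n, Commute b (dxy n)) (k : ℤ) :
    Commute b (DposZ k) := commute_schur (fun _ => (h _).smul_right _) k

theorem commute_DnegZ {b : Module.End ℂ R} (h : ∀ n, Commute b (dxy n)) (k : ℤ) :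
    Commute b (DnegZ k) := commute_schur (fun _ => ((h _).smul_right _).neg_right) k

theorem commute_mulLeft_dxy {g : R} (hg : ∀ n, dxy n g = 0) (n : ℕ) :
    Commute (LinearMap.mulLeft ℂ g) (dxy n) := by
  refine LinearMap.ext fun f => ?_
  simp [dxy_mul, hg]

theorem DposZ_mul_left {g : R} (hg : ∀ n, dxy n g = 0) (k : ℤ) (f : R) :
    DposZ k (g * f) = g * DposZ k f :=
  (LinearMap.congr_fun (commute_DposZ (commute_mulLeft_dxy hg) k).eq f).symm

theorem DnegZ_mul_left {g : R} (hg : ∀ n, dxy n g = 0) (k : ℤ) (f : R) :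
    DnegZ k (g * f) = g * DnegZ k f :=
  (LinearMap.congr_fun (commute_DnegZ (commute_mulLeft_dxy hg) k).eq f).symm

theorem DposZ_DnegZ (k j : ℤ) (f : R) : DposZ k (DnegZ j f) = DnegZ j (DposZ k f) :=
  LinearMap.congr_fun (commute_DnegZ (fun n => (commute_DposZ (fun m => commute_dxy n m) k).symm)
    j).eq f

theorem DposZ_dx (k : ℤ) (r : ℕ) (f : R) : DposZ k (dx r f) = dx r (DposZ k f) :=
  (LinearMap.congr_fun (commute_DposZ (commute_dx_dxy r) k).eq f).symm

/-- The commutator with multiplication by `g`. -/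
def commMul (g : R) : Module.End ℂ R →ₗ[ℂ] Module.End ℂ R :=
  LinearMap.mulRight ℂ (LinearMap.mulLeft ℂ g) - LinearMap.mulLeft ℂ (LinearMap.mulLeft ℂ g)

theorem commMul_apply (g : R) (T : Module.End ℂ R) :
    commMul g T = T * LinearMap.mulLeft ℂ g - LinearMap.mulLeft ℂ g * T := rfl

theorem commMul_mul (g : R) (a b : Module.End ℂ R) :
    commMul g (a * b) = a * commMul g b + commMul g a * b := by
  simp only [commMul_apply, mul_sub, sub_mul, mul_assoc]; abel

theorem commMul_dxy {m n : ℕ} (hm : 0 < m) (hn : 0 < n) :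
    commMul (x m) (dxy n) = if n = m then 1 else 0 := by
  refine LinearMap.ext fun f => ?_
  rw [commMul_apply]
  simp only [LinearMap.sub_apply, Module.End.mul_apply, LinearMap.mulLeft_apply, dxy_mul,
    dxy_x hn hm]
  by_cases h : n = m
  · subst h; simp
  · simp [h, Ne.symm h]

/-- The generating series of `DposZ` is the substitution `x_m ↦ x_m + τ^m/m`. Formally,
`schur_leibniz` is applied to the derivation `commMul (x m)` of the operator algebra. -/
theorem DposZ_x_mul {m : ℕ} (hm : 0 < m) (k : ℤ) (f : R) :
    DposZ k (x m * f) = x m * DposZ k f + (m : ℂ)⁻¹ • DposZ (k - m) f := by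
  have := schur_leibniz (u := fun n : ℕ => (n : ℂ)⁻¹ • dxy n)
    (fun i j => ((commute_dxy i j).smul_left _).smul_right _) (commMul (x m))
    (commMul_mul (x m)) hm (c := (m : ℂ)⁻¹) (fun i => by
      rw [map_smul, commMul_dxy hm (Nat.succ_pos i)]
      split_ifs with h
      · rw [← h]
      · simp) k
  have h2 := LinearMap.congr_fun this f
  rw [commMul_apply] at h2
  exact sub_eq_iff_eq_add'.1 h2

theorem DnegZ_x_mul {m : ℕ} (hm : 0 < m) (k : ℤ) (f : R) :
    DnegZ k (x m * f) = x m * DnegZ k f - (m : ℂ)⁻¹ • DnegZ (k - m) f := by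
  have := schur_leibniz (u := fun n : ℕ => -((n : ℂ)⁻¹ • dxy n))
    (fun i j => (((commute_dxy i j).smul_left _).smul_right _).neg_left.neg_right)
    (commMul (x m)) (commMul_mul (x m)) hm (c := -(m : ℂ)⁻¹) (fun i => by
      rw [map_neg, map_smul, commMul_dxy hm (Nat.succ_pos i)]
      split_ifs with h
      · rw [← h, neg_smul]
      · simp) k
  have h2 := LinearMap.congr_fun this f
  rw [commMul_apply] at h2
  rw [sub_eq_add_neg, ← neg_smul]
  exact sub_eq_iff_eq_add'.1 h2

/-! ### Homogeneity with integer weights, which makes the operator sums finite. -/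

/-- Every monomial of `f` has weight `d`, where `d` may be negative (and then `f = 0`). -/
def IsHomZ (f : R) (d : ℤ) : Prop := ∀ m, MvPowerSeries.coeff m f ≠ 0 → (wt m : ℤ) = d

theorem IsHomZ.eq_zero {f : R} {d : ℤ} (hf : IsHomZ f d) (hd : d < 0) : f = 0 := by
  ext m
  by_contra h
  have := hf m h
  omega

theorem isHomZ_zero (d : ℤ) : IsHomZ 0 d := fun _ h => absurd (map_zero _) h

theorem IsHom.isHomZ {f : R} {d : ℕ} (hf : IsHom f d) : IsHomZ f d := fun m h => by rw [hf m h]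

theorem IsHomZ.add {f g : R} {d : ℤ} (hf : IsHomZ f d) (hg : IsHomZ g d) : IsHomZ (f + g) d := by
  intro m h
  by_contra hh
  rw [map_add, not_not.1 (mt (hf m) hh), not_not.1 (mt (hg m) hh), add_zero] at h
  exact h rfl

theorem IsHomZ.smul {f : R} {d : ℤ} (hf : IsHomZ f d) (c : ℂ) : IsHomZ (c • f) d := by
  intro m h
  rw [map_smul] at h
  exact hf m (right_ne_zero_of_mul h)

theorem IsHomZ.neg {f : R} {d : ℤ} (hf : IsHomZ f d) : IsHomZ (-f) d := by
  simpa using hf.smul (-1)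

theorem IsHomZ.sum {ι : Type*} {s : Finset ι} {f : ι → R} {d : ℤ}
    (hf : ∀ i ∈ s, IsHomZ (f i) d) : IsHomZ (∑ i ∈ s, f i) d :=
  Finset.sum_induction f (IsHomZ · d) (fun _ _ => IsHomZ.add) (isHomZ_zero d) hf

theorem IsHomZ.mul {f g : R} {a b : ℤ} (hf : IsHomZ f a) (hg : IsHomZ g b) :
    IsHomZ (f * g) (a + b) := by
  classical
  intro m h
  rw [MvPowerSeries.coeff_mul] at h
  obtain ⟨q, hq, h⟩ := Finset.exists_ne_zero_of_sum_ne_zero h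
  rw [← Finset.HasAntidiagonal.mem_antidiagonal.1 hq, wt_add, Nat.cast_add,
    hf _ (left_ne_zero_of_mul h), hg _ (right_ne_zero_of_mul h)]

theorem isHomZ_one : IsHomZ 1 0 := by
  classical
  intro m h
  rw [MvPowerSeries.coeff_one] at h
  split_ifs at h with hm
  · simp [hm, wt]
  · exact absurd rfl h

theorem isHomZ_Spos (k : ℤ) : IsHomZ (Spos k) k := by
  rcases lt_or_ge k 0 with h | h
  · rw [Spos_of_neg h]; exact isHomZ_zero k
  · lift k to ℕ using h
    exact (isHom_Spos k).isHomZ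

theorem isHomZ_Sneg (k : ℤ) : IsHomZ (Sneg k) k := by
  rcases lt_or_ge k 0 with h | h
  · rw [Sneg_of_neg h]; exact isHomZ_zero k
  · lift k to ℕ using h
    exact (isHom_Sneg k).isHomZ

theorem wt_single (i : ℕ+ ⊕ ℕ+) (e : ℕ) :
    wt (Finsupp.single i e) = e * Sum.elim (fun n : ℕ+ => (n : ℕ)) (fun n : ℕ+ => (n : ℕ)) i := by
  simp [wt]

theorem IsHomZ.pderiv {f : R} {d : ℤ} (hf : IsHomZ f d) (i : ℕ+ ⊕ ℕ+) :
    IsHomZ (MvPowerSeries.pderiv ℂ i f)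
      (d - (Sum.elim (fun n : ℕ+ => (n : ℕ)) (fun n : ℕ+ => (n : ℕ)) i : ℕ)) := by
  intro m hm
  rw [MvPowerSeries.coeff_pderiv] at hm
  have := hf _ (left_ne_zero_of_mul hm)
  rw [wt_add, wt_single] at this
  omega

theorem IsHomZ.dx {f : R} {d : ℤ} (hf : IsHomZ f d) (n : ℕ) : IsHomZ (dx n f) (d - n) := by
  rcases Nat.eq_zero_or_pos n with rfl | h
  · rw [dx_zero]; exact isHomZ_zero _
  · rw [dx_of_pos h]
    exact hf.pderiv _

theorem IsHomZ.dy {f : R} {d : ℤ} (hf : IsHomZ f d) (n : ℕ) : IsHomZ (dy n f) (d - n) := by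
  rcases Nat.eq_zero_or_pos n with rfl | h
  · rw [dy_zero]; exact isHomZ_zero _
  · rw [dy_of_pos h]
    exact hf.pderiv _

theorem IsHomZ.dxy {f : R} {d : ℤ} (hf : IsHomZ f d) (n : ℕ) : IsHomZ (dxy n f) (d - n) := by
  rw [ChargedBosons.dxy, LinearMap.sub_apply, sub_eq_add_neg]
  exact (hf.dx n).add (hf.dy n).neg

theorem IsHomZ.schur {u : ℕ → Module.End ℂ R} (hu : ∀ i j, Commute (u i) (u j))
    (h : ∀ n f d, IsHomZ f d → IsHomZ (u n f) (d - n)) {f : R} {d : ℤ} (hf : IsHomZ f d) (k : ℤ) :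
    IsHomZ (schur u k f) (d - k) := by
  refine schur_induction hu (P := fun k T => IsHomZ (T f) (d - k)) ?_ ?_ ?_ k
  · simpa using hf
  · intro n _
    exact isHomZ_zero _
  · intro n ih
    rw [LinearMap.smul_apply, LinearMap.sum_apply]
    refine (IsHomZ.sum fun i _ => ?_).smul _
    rw [LinearMap.smul_apply]
    refine IsHomZ.smul ?_ _
    have := h (i + 1) _ _ (ih (n - i) (by omega))
    rwa [show d - ((n : ℤ) - i) - ((i + 1 : ℕ) : ℤ) = d - (n + 1) by push_cast; ring] at this

theorem IsHomZ.DposZ {f : R} {d : ℤ} (hf : IsHomZ f d) (k : ℤ) : IsHomZ (DposZ k f) (d - k) :=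
  hf.schur (fun i j => ((commute_dxy i j).smul_left _).smul_right _)
    (fun n _ _ h => (h.dxy n).smul _) k

theorem IsHomZ.DnegZ {f : R} {d : ℤ} (hf : IsHomZ f d) (k : ℤ) : IsHomZ (DnegZ k f) (d - k) :=
  hf.schur (fun i j => (((commute_dxy i j).smul_left _).smul_right _).neg_left.neg_right)
    (fun n _ _ h => ((h.dxy n).smul _).neg) k

theorem IsHomZ.heis {f : R} {d : ℤ} (hf : IsHomZ f d) (l r : ℤ) :
    IsHomZ (heis l r f) (d - r) := by
  unfold ChargedBosons.heis
  split_ifs with h1 h2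
  · convert hf.dx r.toNat using 1; omega
  · refine IsHomZ.smul ?_ _
    convert (isHom_x _).isHomZ.mul hf using 1; omega
  · obtain rfl : r = 0 := by omega
    simpa using hf.smul l

theorem heis_zero_right (l r : ℤ) : heis l r 0 = 0 := by
  unfold heis; split_ifs <;> simp

theorem heis_sum {ι : Type*} (l r : ℤ) (s : Finset ι) (f : ι → R) :
    heis l r (∑ i ∈ s, f i) = ∑ i ∈ s, heis l r (f i) := by
  unfold heis
  split_ifs
  · rw [map_sum]
  · rw [Finset.mul_sum, Finset.smul_sum]
  · rw [Finset.smul_sum]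

/-- Only the multiplications by `x_{-r}` fail to commute with the shift. The factor `-r` in `heis`
cancels the denominator of the shift. -/
theorem DposZ_heis (k l r : ℤ) (f : R) :
    DposZ k (heis l r f) = heis l r (DposZ k f) + if r < 0 then DposZ (k + r) f else 0 := by
  unfold heis
  split_ifs with h1 h2 h3
  · omega
  · rw [DposZ_dx, add_zero]
  · rw [map_smul, DposZ_x_mul (by omega), smul_add, smul_smul]
    congr 1
    have hc : (((-r).toNat : ℕ) : ℂ) = ((-r : ℤ) : ℂ) := by
      rw [← Int.cast_natCast, Int.toNat_of_nonneg (by omega)]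
    have hne : ((-r : ℤ) : ℂ) ≠ 0 := by exact_mod_cast (show -r ≠ 0 by omega)
    rw [hc, mul_inv_cancel₀ hne, one_smul, Int.toNat_of_nonneg (by omega), sub_neg_eq_add]
  · rw [map_smul, add_zero]

/-- For `r > 0` the correction is the derivative of the Schur polynomial. For `r = 0` it is the drop
of the charge from `l` to `l - 1`, which happens to have the same shape, so one formula covers all
`r ≥ 0`. -/
theorem heis_Sneg_mul (l r q : ℤ) (g : R) :
    heis (l - 1) r (Sneg q * g) =
      Sneg q * heis l r g - if 0 ≤ r then Sneg (q - r) * g else 0 := by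
  unfold heis
  split_ifs with h1 h2 h3 h4
  · rw [dx_mul, dx_Sneg (by omega), Int.toNat_of_nonneg h2]; ring
  · omega
  · omega
  · rw [mul_smul_comm]; simp only [sub_zero]; congr 1; ring
  · obtain rfl : r = 0 := by omega
    rw [sub_zero, mul_smul_comm]; push_cast; module
  · omega

/-! ### The modes on a single power of `p`, as finite sums on homogeneous elements. -/

theorem coeff_formalSum {ι : Type*} (F : ι → R) (m : (ℕ+ ⊕ ℕ+) →₀ ℕ) :
    MvPowerSeries.coeff m (formalSum F) = ∑ᶠ i, MvPowerSeries.coeff m (F i) := rfl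

theorem formalSum_eq_sum {ι : Type*} {F : ι → R} (s : Finset ι) (h : ∀ i ∉ s, F i = 0) :
    formalSum F = ∑ i ∈ s, F i := by
  ext m
  rw [coeff_formalSum, map_sum]
  refine finsum_eq_sum_of_support_subset _ fun i hi => ?_
  by_contra hs
  exact hi (by simp [h i hs])

/-- The action of `φ_i` on a single power of `p`. -/
def phiR (i : ℤ) (f : R) : R := formalSum fun k : ℕ => Sneg (k - i - 1) * Dpos k f

/-- The action of `φ*_i` on `p^l ℂ[[x, y]]`. -/
def phiStarR (l i : ℤ) (f : R) : R := formalSum fun q : ℤ × ℕ =>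
  Spos (q.1 + 1 + q.2 - i) * heis l q.1 (Dneg q.2 f)

theorem phi_single (i l : ℤ) (f : R) :
    phi i (Pi.single l f) = (Pi.single (l - 1) (phiR i f) : B) := by
  funext l'
  by_cases h : l' = l - 1
  · subst h
    simp [phi, phiR]
  · rw [Pi.single_eq_of_ne h, phi, Pi.single_eq_of_ne (by omega)]
    rw [formalSum_eq_sum ∅ (by simp)]; rfl

theorem phiStar_single (i l : ℤ) (f : R) :
    phiStar i (Pi.single l f) = (Pi.single (l + 1) (phiStarR l i f) : B) := by
  funext l'
  by_cases h : l' = l + 1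
  · subst h
    simp [phiStar, phiStarR]
  · rw [Pi.single_eq_of_ne h, phiStar, Pi.single_eq_of_ne (by omega)]
    rw [formalSum_eq_sum ∅ (by simp [heis_zero_right])]; rfl

theorem phiR_eq_sum {f : R} {d : ℤ} (hf : IsHomZ f d) (i : ℤ) {N : ℕ} (hN : d ≤ N) :
    phiR i f = ∑ k ∈ Finset.range (N + 1), Sneg (k - i - 1) * DposZ k f := by
  refine formalSum_eq_sum _ fun k hk => ?_
  rw [Finset.mem_range] at hk
  rw [Dpos_eq, (hf.DposZ k).eq_zero (by omega), mul_zero]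

/-- In a nonzero term the weight `d` bounds `k` and `r + k` from above, and the index of `Spos` then
bounds `r` from below by `i - 1 - d`. -/
theorem phiStarR_eq_sum {f : R} {d : ℤ} (hf : IsHomZ f d) (l i : ℤ) {N M : ℕ} (hN : d ≤ N)
    (hM : d ≤ M) (hM' : d + 1 - i ≤ M) :
    phiStarR l i f = ∑ k ∈ Finset.range (N + 1), ∑ r ∈ Finset.Icc (-(M : ℤ)) M,
      Spos (r + 1 + k - i) * heis l r (DnegZ k f) := by
  rw [Finset.sum_comm, ← Finset.sum_product']
  refine formalSum_eq_sum _ fun q hq => ?_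
  by_contra h
  have h1 : heis l q.1 (DnegZ q.2 f) ≠ 0 := right_ne_zero_of_mul h
  have h2 : DnegZ q.2 f ≠ 0 := fun h0 => h1 (by rw [h0, heis_zero_right])
  have h3 : 0 ≤ q.1 + 1 + q.2 - i := by
    by_contra h0
    exact left_ne_zero_of_mul h (Spos_of_neg (by omega))
  have h4 := mt (hf.DnegZ q.2).eq_zero h2
  have h5 := mt ((hf.DnegZ q.2).heis l q.1).eq_zero h1
  apply hq
  rw [Finset.mem_product, Finset.mem_Icc, Finset.mem_range]
  omega

theorem IsHomZ.phiR {f : R} {d : ℤ} (hf : IsHomZ f d) (i : ℤ) :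
    IsHomZ (phiR i f) (d - i - 1) := by
  rw [phiR_eq_sum hf i (Int.self_le_toNat d)]
  refine IsHomZ.sum fun k _ => ?_
  convert (isHomZ_Sneg _).mul (hf.DposZ k) using 1
  ring

theorem IsHomZ.phiStarR {f : R} {d : ℤ} (hf : IsHomZ f d) (l i : ℤ) :
    IsHomZ (phiStarR l i f) (d - i + 1) := by
  rw [phiStarR_eq_sum hf l i (N := d.toNat) (M := d.toNat + (d + 1 - i).toNat)
    (by omega) (by omega) (by omega)]
  refine IsHomZ.sum fun k _ => IsHomZ.sum fun r _ => ?_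
  convert (isHomZ_Spos _).mul ((hf.DnegZ k).heis l r) using 1
  ring

/-! ### Commutation of the modes `φ_i` and `φ*_j` for `i + j < 0`. -/

theorem sum_range_eq_finsum {M : Type*} [AddCommMonoid M] (F : ℤ → M) (a : ℤ) (N : ℕ)
    (h : ∀ k, k < a ∨ a + N < k → F k = 0) :
    ∑ k ∈ Finset.range (N + 1), F (k + a) = ∑ᶠ k, F k := by
  rw [finsum_eq_sum_of_support_subset F (s := Finset.Icc a (a + N))]
  · refine Finset.sum_bij (fun k _ => (k : ℤ) + a) ?_ ?_ ?_ ?_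
    · intro k hk
      rw [Finset.mem_range] at hk
      rw [Finset.mem_Icc]; omega
    · intro k _ k' _ hkk
      omega
    · intro k hk
      rw [Finset.mem_Icc] at hk
      exact ⟨(k - a).toNat, by rw [Finset.mem_range]; omega, by omega⟩
    · intro k _; rfl
  · intro k hk
    by_contra hs
    rw [Finset.coe_Icc, Set.mem_Icc] at hs
    exact hk (h k (by omega))

theorem sum_Spos_mul_Sneg_Icc {n c M : ℤ} (hn : 0 < n) (h1 : -M ≤ -c) (h2 : n - c ≤ M) :
    ∑ r ∈ Finset.Icc (-M) M, Spos (r + c) * Sneg (n - (r + c)) = 0 := by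
  lift n to ℕ using hn.le
  rw [← sum_Spos_mul_Sneg (n := n) (by omega)]
  have h0 : ∀ k : ℤ, k < 0 ∨ n < k → Spos k * Sneg (n - k) = 0 := by
    rintro k (h | h)
    · rw [Spos_of_neg h, zero_mul]
    · rw [Sneg_of_neg (by omega), mul_zero]
  have := sum_range_eq_finsum (fun k => Spos k * Sneg (n - k)) 0 n (by simpa using h0)
  simp only [add_zero] at this
  rw [this, ← finsum_comp_equiv (Equiv.addRight c)]
  refine (finsum_eq_sum_of_support_subset _ fun k hk => ?_).symm
  by_contra hs
  rw [Finset.coe_Icc, Set.mem_Icc] at hs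
  exact hk (h0 (k + c) (by omega))

/-- The modes `φ_i` and `φ*_j` commute if `i + j < 0`. -/
theorem phiR_phiStarR {f : R} {d : ℤ} (hf : IsHomZ f d) (l : ℤ) {i j : ℤ} (hij : i + j < 0) :
    phiR i (phiStarR l j f) = phiStarR (l - 1) j (phiR i f) := by
  -- `M` exceeds every bound on `r` in the two truncations; `N = 2M` leaves room for translating `k`
  -- by any `r` with `|r| ≤ M`.
  set M : ℕ := d.natAbs + i.natAbs + j.natAbs + 2
  set N : ℕ := 2 * M
  rw [phiR_eq_sum (hf.phiStarR l j) i (N := N) (by omega),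
    phiStarR_eq_sum (hf.phiR i) (l - 1) j (N := N) (M := M) (by omega) (by omega) (by omega),
    phiStarR_eq_sum hf l j (N := N) (M := M) (by omega) (by omega) (by omega),
    phiR_eq_sum hf i (N := N) (by omega)]
  set I := Finset.range (N + 1)
  set J := Finset.Icc (-(M : ℤ)) M
  have hL : ∑ k ∈ I, Sneg (k - i - 1) * DposZ k (∑ k' ∈ I, ∑ r ∈ J,
      Spos (r + 1 + k' - j) * heis l r (DnegZ k' f)) =
      ∑ k' ∈ I, ∑ r ∈ J, ∑ k ∈ I, (Sneg (k - i - 1) * Spos (r + 1 + k' - j) *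
          heis l r (DposZ k (DnegZ k' f)) +
        Spos (r + 1 + k' - j) * (if r < 0 then Sneg ((k + r) - r - i - 1) *
          DposZ (k + r) (DnegZ k' f) else 0)) := by
    simp only [map_sum, Finset.mul_sum]
    rw [Finset.sum_comm]
    refine Finset.sum_congr rfl fun k' _ => ?_
    rw [Finset.sum_comm]
    refine Finset.sum_congr rfl fun r _ => Finset.sum_congr rfl fun k _ => ?_
    rw [DposZ_mul_left fun n => dxy_Spos n _, DposZ_heis, add_sub_cancel_right]
    split_ifs <;> ring
  have hR : ∑ k' ∈ I, ∑ r ∈ J, Spos (r + 1 + k' - j) *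
      heis (l - 1) r (DnegZ k' (∑ k ∈ I, Sneg (k - i - 1) * DposZ k f)) =
      ∑ k' ∈ I, ∑ r ∈ J, ∑ k ∈ I, (Sneg (k - i - 1) * Spos (r + 1 + k' - j) *
          heis l r (DposZ k (DnegZ k' f)) -
        Spos (r + 1 + k' - j) * (if 0 ≤ r then Sneg (k - r - i - 1) *
          DposZ k (DnegZ k' f) else 0)) := by
    refine Finset.sum_congr rfl fun k' _ => Finset.sum_congr rfl fun r _ => ?_
    rw [map_sum, heis_sum, Finset.mul_sum]
    refine Finset.sum_congr rfl fun k _ => ?_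
    rw [DnegZ_mul_left fun n => dxy_Sneg n _, heis_Sneg_mul, DposZ_DnegZ,
      show (k : ℤ) - i - 1 - r = k - r - i - 1 by ring]
    split_ifs <;> ring
  -- The fully reordered main terms agree; only the corrections with `r < 0` on one side and `r ≥ 0`
  -- on the other remain.
  rw [hL, hR, ← sub_eq_zero]
  simp only [← Finset.sum_sub_distrib, add_sub_sub_cancel, ← mul_add]
  -- The summand is supported in `0 ≤ k ≤ d`, so replacing `k + r` by `k` loses nothing. Afterwards
  -- the two half-sums over `r` join into one sum over all `r`.
  have hshift : ∀ k' ∈ I, ∀ r ∈ J, ∑ k ∈ I, (if r < 0 then Sneg ((k + r) - r - i - 1) *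
      DposZ (k + r) (DnegZ k' f) else 0) =
      ∑ k ∈ I, (if r < 0 then Sneg (k - r - i - 1) * DposZ k (DnegZ k' f) else 0) := by
    intro k' _ r hr
    rw [Finset.mem_Icc] at hr
    have h0 : ∀ k : ℤ, k < 0 ∨ d < k → DposZ k (DnegZ k' f) = 0 := by
      rintro k (h | h)
      · rw [DposZ_of_neg h]; rfl
      · exact ((hf.DnegZ k').DposZ k).eq_zero (by omega)
    by_cases hr0 : r < 0
    · simp only [hr0, if_true]
      have e1 := sum_range_eq_finsum (fun k => Sneg (k - r - i - 1) * DposZ k (DnegZ k' f)) r N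
        fun k hk => by rw [h0 k (by omega), mul_zero]
      have e2 := sum_range_eq_finsum (fun k => Sneg (k - r - i - 1) * DposZ k (DnegZ k' f)) 0 N
        fun k hk => by rw [h0 k (by omega), mul_zero]
      simp only [add_zero] at e2
      rw [e2, ← e1]
    · simp [hr0]
  have hterm : ∀ k' ∈ I, ∀ r ∈ J, ∑ k ∈ I, Spos (r + 1 + k' - j) *
      ((if r < 0 then Sneg ((k + r) - r - i - 1) * DposZ (k + r) (DnegZ k' f) else 0) +
        if 0 ≤ r then Sneg (k - r - i - 1) * DposZ k (DnegZ k' f) else 0) =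
      ∑ k ∈ I, Spos (r + (1 + k' - j)) * Sneg ((k + k' - i - j : ℤ) - (r + (1 + k' - j))) *
        DposZ k (DnegZ k' f) := by
    intro k' hk' r hr
    rw [← Finset.mul_sum, Finset.sum_add_distrib, hshift k' hk' r hr, ← Finset.sum_add_distrib,
      Finset.mul_sum]
    refine Finset.sum_congr rfl fun k _ => ?_
    rw [show r + 1 + k' - j = r + (1 + k' - j) by ring,
      show (k + k' - i - j : ℤ) - (r + (1 + k' - j)) = k - r - i - 1 by ring]
    by_cases hr0 : r < 0
    · simp [hr0, not_le.2 hr0, mul_assoc]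
    · simp [hr0, not_lt.1 hr0, mul_assoc]
  rw [Finset.sum_congr rfl fun k' hk' => Finset.sum_congr rfl fun r hr => hterm k' hk' r hr]
  refine Finset.sum_eq_zero fun k' _ => ?_
  rw [Finset.sum_comm]
  refine Finset.sum_eq_zero fun k _ => ?_
  rw [← Finset.sum_mul]
  -- A nonzero term has `k + k' ≤ d`, which places the support of the convolution inside `[-M, M]`;
  -- its degree `k + k' - i - j` is positive because `i + j < 0`.
  by_cases h : DposZ k (DnegZ k' f) = 0
  · rw [h, mul_zero]
  have := mt ((hf.DnegZ k').DposZ k).eq_zero h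
  rw [sum_Spos_mul_Sneg_Icc (by omega) (by omega) (by omega), zero_mul]

/-! ### The series `Q(τ)` and the elements `p_n`. -/

/-- The polynomial `∑_{m=0}^{t} S_m(x + y) τ^{t+1-m}` in `τ = z⁻¹`. -/
def Qpoly (t : ℕ) : Polynomial R :=
  ∑ m ∈ Finset.range (t + 1), Polynomial.C (Spos m) * Polynomial.X ^ (t + 1 - m)

/-- The polynomial `Qpoly t` as a power series. -/
def Qser (t : ℕ) : PowerSeries R := Qpoly t

theorem fcoef_eq (t n i : ℕ) (h : i ≤ n * (t + 1)) :
    fcoef t n i = PowerSeries.coeff (n * (t + 1) - i) (Qser t ^ n) := by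
  have h1 : (∑ m ∈ Finset.range (t + 1),
      LaurentPolynomial.C (Spos m) * LaurentPolynomial.T (-(t : ℤ) - 1 + m) : R[T;T⁻¹]) =
      LaurentPolynomial.invert (Polynomial.toLaurent (Qpoly t)) := by
    rw [Qpoly, map_sum, map_sum]
    refine Finset.sum_congr rfl fun m hm => ?_
    rw [Finset.mem_range] at hm
    rw [Polynomial.toLaurent_C_mul_X_pow, map_mul, LaurentPolynomial.invert_C,
      LaurentPolynomial.invert_T]
    congr 2
    push_cast [Nat.cast_sub (show m ≤ t + 1 by omega)]
    ring
  rw [fcoef, h1, ← map_pow, ← map_pow, LaurentPolynomial.invert_apply, Qser,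
    ← Polynomial.coe_pow, Polynomial.coeff_coe,
    show -(-((n : ℤ) * (t + 1)) + i) = ((n * (t + 1) - i : ℕ) : ℤ) by
      push_cast [Nat.cast_sub h]; ring]
  exact Finsupp.mapDomain_apply Nat.castEmbedding.injective _ _

theorem coeff_Qser (t N : ℕ) :
    PowerSeries.coeff N (Qser t) = if N = 0 then 0 else Spos ((t : ℤ) + 1 - N) := by
  rw [Qser, Polynomial.coeff_coe, Qpoly, Polynomial.finsetSum_coeff]
  simp only [Polynomial.coeff_C_mul_X_pow]
  by_cases h0 : N = 0
  · subst h0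
    rw [if_pos rfl]
    refine Finset.sum_eq_zero fun m hm => ?_
    rw [Finset.mem_range] at hm
    rw [if_neg (by omega)]
  rw [if_neg h0]
  by_cases h : N ≤ t + 1
  · rw [Finset.sum_eq_single (t + 1 - N)]
    · rw [if_pos (by omega)]
      congr 1
      omega
    · intro m hm hne
      rw [Finset.mem_range] at hm
      rw [if_neg (by omega)]
    · intro hm
      rw [Finset.mem_range] at hm
      omega
  · rw [Spos_of_neg (by omega)]
    refine Finset.sum_eq_zero fun m hm => ?_
    rw [if_neg (by omega)]

theorem Qser_eq_X_mul (t : ℕ) :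
    Qser t = PowerSeries.X * PowerSeries.mk fun N => Spos ((t : ℤ) - N) := by
  ext N
  rw [coeff_Qser]
  cases N with
  | zero => simp
  | succ N =>
    rw [if_neg (Nat.succ_ne_zero N), PowerSeries.coeff_succ_X_mul, PowerSeries.coeff_mk]
    congr 2
    push_cast; ring

theorem coeff_Qser_pow_of_lt (t : ℕ) {n N : ℕ} (h : N < n) :
    PowerSeries.coeff N (Qser t ^ n) = 0 := by
  rw [Qser_eq_X_mul, mul_pow, PowerSeries.coeff_X_pow_mul', if_neg (by omega)]

theorem coeff_Qser_pow_of_gt (t : ℕ) {n N : ℕ} (h : n * (t + 1) < N) :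
    PowerSeries.coeff N (Qser t ^ n) = 0 := by
  rw [Qser, ← Polynomial.coe_pow, Polynomial.coeff_coe]
  refine Polynomial.coeff_eq_zero_of_natDegree_lt (lt_of_le_of_lt ?_ h)
  refine Polynomial.natDegree_pow_le_of_le n (Polynomial.natDegree_sum_le_of_forall_le _ _ ?_)
  intro m _
  exact (Polynomial.natDegree_C_mul_X_pow_le _ _).trans (Nat.sub_le _ _)

theorem isHomZ_coeff_Qser_pow (t n N : ℕ) :
    IsHomZ (PowerSeries.coeff N (Qser t ^ n)) ((n * (t + 1) : ℤ) - N) := by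
  induction n generalizing N with
  | zero =>
    rw [pow_zero, PowerSeries.coeff_one]
    split_ifs with h
    · subst h; simpa using isHomZ_one
    · exact isHomZ_zero _
  | succ n ih =>
    rw [pow_succ, PowerSeries.coeff_mul]
    refine IsHomZ.sum fun q hq => ?_
    rw [← Finset.HasAntidiagonal.mem_antidiagonal.1 hq]
    have : IsHomZ (PowerSeries.coeff q.2 (Qser t)) ((t : ℤ) + 1 - q.2) := by
      rw [coeff_Qser]
      split_ifs
      · exact isHomZ_zero _
      · exact isHomZ_Spos _
    convert (ih q.1).mul this using 1
    push_cast; ring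

/-- The linear functional `τ^N ↦ N x_N`, truncated at `N < M`. -/
def wsum (M : ℕ) : PowerSeries R →ₗ[R] R :=
  ∑ N ∈ Finset.range M, ((N : ℂ) • x N) • PowerSeries.coeff N

theorem wsum_apply (M : ℕ) (f : PowerSeries R) :
    wsum M f = ∑ N ∈ Finset.range M, ((N : ℂ) • x N) * PowerSeries.coeff N f := by
  simp [wsum]

/-- Under `τ = z⁻¹` the coefficient `f_i` sits at `τ^{n(t+1)-i}`, so the definition of `p_n` becomes
a linear functional of `Q^n`. The cutoff is free since `Q^n` lives in degrees `n` to `n(t+1)`. -/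
theorem pcoef_eq_wsum (t n : ℕ) {M : ℕ} (hM : n * (t + 1) < M) :
    pcoef t n = wsum M (Qser t ^ n) := by
  rw [wsum_apply, pcoef]
  rw [← Finset.sum_subset (s₁ := Finset.Icc n (n * (t + 1))) (s₂ := Finset.range M)]
  · refine Finset.sum_bij' (fun i _ => n * (t + 1) - i) (fun i _ => n * (t + 1) - i) ?_ ?_ ?_ ?_ ?_
    · intro i hi
      rw [Finset.mem_range] at hi
      rw [Finset.mem_Icc, mul_add, mul_one]; omega
    · intro N hN
      rw [Finset.mem_Icc, mul_add, mul_one] at hN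
      rw [Finset.mem_range, mul_add, mul_one]; omega
    · intro i hi
      rw [Finset.mem_range] at hi
      rw [mul_add, mul_one]; omega
    · intro N hN
      rw [Finset.mem_Icc] at hN
      omega
    · intro i hi
      rw [Finset.mem_range] at hi
      rw [fcoef_eq t n i (by rw [mul_add]; omega), mul_comm]
  · intro N hN
    rw [Finset.mem_Icc] at hN
    rw [Finset.mem_range]; omega
  · intro N _ hN
    rw [Finset.mem_Icc, not_and_or, not_le, not_le] at hN
    rcases hN with h | h
    · rw [coeff_Qser_pow_of_lt t h, mul_zero]
    · rw [coeff_Qser_pow_of_gt t h, mul_zero]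

theorem isHomZ_pcoef (t n : ℕ) : IsHomZ (pcoef t n) (n * (t + 1)) := by
  rw [pcoef_eq_wsum t n (Nat.lt_succ_self _), wsum_apply]
  refine IsHomZ.sum fun N _ => ?_
  convert ((isHom_x N).isHomZ.smul (N : ℂ)).mul (isHomZ_coeff_Qser_pow t n N) using 1
  ring

/-! ### The series `T(ε)`, the geometric series in `εQ`, and their logarithmic derivatives. -/

/-- The coefficients of `exp (-∑ p_n ε^n / n)`. -/
def Tcoef (t : ℕ) (k : ℤ) : R := schur (fun n => -((n : ℂ)⁻¹ • pcoef t n)) k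

theorem Tcoef_zero (t : ℕ) : Tcoef t 0 = 1 := schur_zero _

theorem isHomZ_schur {u : ℕ → R} {w : ℤ} (h : ∀ n : ℕ, IsHomZ (u n) (n * w)) (k : ℤ) :
    IsHomZ (schur u k) (k * w) := by
  refine schur_induction (commute_all_R u) (P := fun k S => IsHomZ S (k * w)) ?_ ?_ ?_ k
  · simpa using isHomZ_one
  · intro n _
    exact isHomZ_zero _
  · intro n ih
    refine (IsHomZ.sum fun i _ => ?_).smul _
    refine IsHomZ.smul ?_ _
    convert (h (i + 1)).mul (ih (n - i) (by omega)) using 1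
    push_cast; ring

theorem isHomZ_Tcoef (t : ℕ) (k : ℤ) : IsHomZ (Tcoef t k) (k * (t + 1)) :=
  isHomZ_schur (fun n => ((isHomZ_pcoef t n).smul _).neg) k

/-- The generating series of the `Tcoef t k`, with coefficients in `ℂ[[x, y]][[τ]]`. -/
def Tser (t : ℕ) : PowerSeries (PowerSeries R) :=
  PowerSeries.mk fun k : ℕ => PowerSeries.C (Tcoef t k)

/-- The generating series of the `p_n`, `n ≥ 1`. -/
def Pser (t : ℕ) : PowerSeries (PowerSeries R) :=
  PowerSeries.mk fun n : ℕ => if n = 0 then 0 else PowerSeries.C (pcoef t n)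

/-- The generating series of the powers of `Qser t`. -/
def Qgeom (t : ℕ) : PowerSeries (PowerSeries R) := PowerSeries.mk fun n => Qser t ^ n

theorem smul_C (c : ℂ) (r : R) : c • (PowerSeries.C r : PowerSeries R) = PowerSeries.C (c • r) := by
  ext n
  rw [PowerSeries.coeff_smul, PowerSeries.coeff_C, PowerSeries.coeff_C]
  split_ifs <;> simp

theorem eulerPS_Tser (t : ℕ) : eulerPS (Tser t) = -Pser t * Tser t := by
  ext1 k
  have h := congrArg (PowerSeries.coeff k)
    (eulerPS_schur (commute_all_R fun n => -((n : ℂ)⁻¹ • pcoef t n)))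
  rw [PowerSeries.coeff_mul] at h
  simp only [eulerPS, schurExp, PowerSeries.coeff_mk] at h
  rw [PowerSeries.coeff_mul]
  simp only [eulerPS, Tser, Pser, PowerSeries.coeff_mk, map_neg]
  rw [smul_C, Tcoef, h, map_sum]
  refine Finset.sum_congr rfl fun q _ => ?_
  rw [map_mul]
  congr 1
  by_cases h0 : q.1 = 0
  · simp [h0]
  · rw [if_neg h0, if_neg h0, smul_neg, smul_smul, mul_inv_cancel₀ (by exact_mod_cast h0),
      one_smul, map_neg]

theorem Qgeom_mul (t : ℕ) : Qgeom t * (1 - PowerSeries.X * PowerSeries.C (Qser t)) = 1 := by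
  ext1 n
  rw [mul_sub, mul_one, map_sub, ← mul_assoc, mul_comm _ PowerSeries.X, mul_assoc,
    PowerSeries.coeff_one]
  cases n with
  | zero => simp [Qgeom]
  | succ n => simp [Qgeom, pow_succ, PowerSeries.coeff_succ_X_mul]

theorem eulerPS_one {A : Type*} [Ring A] [Algebra ℂ A] : eulerPS (1 : PowerSeries A) = 0 := by
  have := eulerPS_mul (1 : PowerSeries A) 1
  simpa using this

theorem eulerPS_one_sub (t : ℕ) :
    eulerPS (1 - PowerSeries.X * PowerSeries.C (Qser t)) =
      -(Qgeom t - 1) * (1 - PowerSeries.X * PowerSeries.C (Qser t)) := by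
  have h : -(Qgeom t - 1) * (1 - PowerSeries.X * PowerSeries.C (Qser t)) =
      -(PowerSeries.X * PowerSeries.C (Qser t)) := by linear_combination -Qgeom_mul t
  rw [h]
  ext1 n
  rw [eulerPS, PowerSeries.coeff_mk, map_sub, map_neg, PowerSeries.coeff_one]
  rcases n with _ | _ | n
  · simp
  · simp
  · simp [PowerSeries.coeff_X]

theorem eulerPS_Qgeom (t : ℕ) : eulerPS (Qgeom t) = (Qgeom t - 1) * Qgeom t := by
  have h := congrArg eulerPS (Qgeom_mul t)
  rw [eulerPS_mul, eulerPS_one, eulerPS_one_sub] at h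
  linear_combination Qgeom t * h + ((Qgeom t - 1) * Qgeom t - eulerPS (Qgeom t)) * Qgeom_mul t

/-- Uniqueness of the solution of the differential equation `z Y' = V Y`. -/
theorem eq_of_eulerPS_eq {A : Type*} [CommRing A] [Algebra ℂ A] {V Y Z : PowerSeries A}
    (hV : PowerSeries.coeff 0 V = 0) (hY : eulerPS Y = V * Y) (hZ : eulerPS Z = V * Z)
    (h0 : PowerSeries.coeff 0 Y = PowerSeries.coeff 0 Z) : Y = Z := by
  ext n
  induction n using Nat.strong_induction_on with
  | _ n ih =>
  rcases Nat.eq_zero_or_pos n with rfl | hn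
  · exact h0
  have e1 := congrArg (PowerSeries.coeff n) hY
  have e2 := congrArg (PowerSeries.coeff n) hZ
  rw [PowerSeries.coeff_mul] at e1 e2
  have : ∑ q ∈ Finset.HasAntidiagonal.antidiagonal n,
        PowerSeries.coeff q.1 V * PowerSeries.coeff q.2 Y =
      ∑ q ∈ Finset.HasAntidiagonal.antidiagonal n,
        PowerSeries.coeff q.1 V * PowerSeries.coeff q.2 Z := by
    refine Finset.sum_congr rfl fun q hq => ?_
    have hq := Finset.HasAntidiagonal.mem_antidiagonal.1 hq
    rcases Nat.eq_zero_or_pos q.1 with h | h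
    · rw [h, hV, zero_mul, zero_mul]
    · rw [ih q.2 (by omega)]
  rw [this, ← e2, eulerPS, eulerPS, PowerSeries.coeff_mk, PowerSeries.coeff_mk] at e1
  exact smul_right_injective _ (show (n : ℂ) ≠ 0 by exact_mod_cast hn.ne') e1

/-! ### The shift operators on `p_n` and on `T(ε)`. -/

/-- The generating series of the `DposZ N f`, `N ≥ 0`. -/
def Gpos (f : R) : PowerSeries R := PowerSeries.mk fun N : ℕ => DposZ N f

/-- The generating series of the `DnegZ N f`, `N ≥ 0`. -/
def Gneg (f : R) : PowerSeries R := PowerSeries.mk fun N : ℕ => DnegZ N f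

theorem Gpos_one : Gpos 1 = 1 := by
  ext1 N
  rw [Gpos, PowerSeries.coeff_mk, PowerSeries.coeff_one]
  split_ifs with h
  · subst h
    rw [Nat.cast_zero, DposZ, schur_zero]; rfl
  · exact (isHomZ_one.DposZ N).eq_zero (by omega)

theorem Gneg_one : Gneg 1 = 1 := by
  ext1 N
  rw [Gneg, PowerSeries.coeff_mk, PowerSeries.coeff_one]
  split_ifs with h
  · subst h
    rw [Nat.cast_zero, DnegZ, schur_zero]; rfl
  · exact (isHomZ_one.DnegZ N).eq_zero (by omega)

theorem Gpos_x_mul {m : ℕ} (hm : 0 < m) (f : R) :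
    Gpos (((m : ℂ) • x m) * f) =
      (PowerSeries.C ((m : ℂ) • x m) + PowerSeries.X ^ m) * Gpos f := by
  ext1 N
  have hm0 : (m : ℂ) ≠ 0 := by exact_mod_cast hm.ne'
  rw [add_mul, map_add, PowerSeries.coeff_C_mul, PowerSeries.coeff_X_pow_mul', Gpos, Gpos,
    PowerSeries.coeff_mk, PowerSeries.coeff_mk, smul_mul_assoc, map_smul, DposZ_x_mul hm, smul_add,
    smul_mul_assoc, smul_smul, mul_inv_cancel₀ hm0, one_smul]
  congr 1
  split_ifs with h
  · rw [PowerSeries.coeff_mk, Nat.cast_sub h]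
  · rw [DposZ_of_neg (by omega)]; rfl

theorem Gneg_x_mul {m : ℕ} (hm : 0 < m) (f : R) :
    Gneg (((m : ℂ) • x m) * f) =
      (PowerSeries.C ((m : ℂ) • x m) - PowerSeries.X ^ m) * Gneg f := by
  ext1 N
  have hm0 : (m : ℂ) ≠ 0 := by exact_mod_cast hm.ne'
  rw [sub_mul, map_sub, PowerSeries.coeff_C_mul, PowerSeries.coeff_X_pow_mul', Gneg, Gneg,
    PowerSeries.coeff_mk, PowerSeries.coeff_mk, smul_mul_assoc, map_smul, DnegZ_x_mul hm, smul_sub,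
    smul_mul_assoc, smul_smul, mul_inv_cancel₀ hm0, one_smul]
  congr 1
  split_ifs with h
  · rw [PowerSeries.coeff_mk, Nat.cast_sub h]
  · rw [DnegZ_of_neg (by omega)]; rfl

/-- Constants for the derivations `∂x_n - ∂y_n`. -/
def IsConst (g : R) : Prop := ∀ n, dxy n g = 0

theorem IsConst.mul {f g : R} (hf : IsConst f) (hg : IsConst g) : IsConst (f * g) := fun n => by
  rw [dxy_mul, hf, hg, mul_zero, zero_mul, add_zero]

theorem IsConst.sum {ι : Type*} {s : Finset ι} {f : ι → R} (h : ∀ i ∈ s, IsConst (f i)) :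
    IsConst (∑ i ∈ s, f i) := fun n => by
  rw [map_sum]
  exact Finset.sum_eq_zero fun i hi => h i hi n

theorem isConst_Spos (k : ℤ) : IsConst (Spos k) := fun n => dxy_Spos n k

theorem isConst_Sneg (k : ℤ) : IsConst (Sneg k) := fun n => dxy_Sneg n k

theorem isConst_zero : IsConst 0 := fun _ => map_zero _

theorem isConst_one : IsConst 1 := by simpa [Spos_zero] using isConst_Spos 0

theorem isConst_coeff_pow {A : PowerSeries R} (hA : ∀ N, IsConst (PowerSeries.coeff N A))
    (n N : ℕ) : IsConst (PowerSeries.coeff N (A ^ n)) := by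
  induction n generalizing N with
  | zero =>
    rw [pow_zero, PowerSeries.coeff_one]
    split_ifs
    exacts [isConst_one, isConst_zero]
  | succ n ih =>
    rw [pow_succ, PowerSeries.coeff_mul]
    exact IsConst.sum fun q _ => (ih q.1).mul (hA q.2)

theorem isConst_coeff_Qser (t N : ℕ) : IsConst (PowerSeries.coeff N (Qser t)) := by
  rw [coeff_Qser]
  split_ifs
  exacts [isConst_zero, isConst_Spos _]

theorem Gpos_const_mul {g : R} (hg : IsConst g) (f : R) :
    Gpos (g * f) = PowerSeries.C g * Gpos f := by
  ext1 N
  rw [PowerSeries.coeff_C_mul, Gpos, Gpos, PowerSeries.coeff_mk, PowerSeries.coeff_mk,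
    DposZ_mul_left hg]

theorem Gneg_const_mul {g : R} (hg : IsConst g) (f : R) :
    Gneg (g * f) = PowerSeries.C g * Gneg f := by
  ext1 N
  rw [PowerSeries.coeff_C_mul, Gneg, Gneg, PowerSeries.coeff_mk, PowerSeries.coeff_mk,
    DnegZ_mul_left hg]

/-- `Gpos` as a linear map. -/
def GposL : R →ₗ[ℂ] PowerSeries R where
  toFun := Gpos
  map_add' f g := by ext1 N; simp [Gpos]
  map_smul' c f := by ext1 N; simp [Gpos]

/-- `Gneg` as a linear map. -/
def GnegL : R →ₗ[ℂ] PowerSeries R where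
  toFun := Gneg
  map_add' f g := by ext1 N; simp [Gneg]
  map_smul' c f := by ext1 N; simp [Gneg]

theorem sum_C_mul_X_pow (F : PowerSeries R) {M : ℕ} (h : ∀ N, M ≤ N → PowerSeries.coeff N F = 0) :
    ∑ N ∈ Finset.range M, PowerSeries.C (PowerSeries.coeff N F) * PowerSeries.X ^ N = F := by
  ext1 N
  rw [map_sum]
  simp only [PowerSeries.coeff_C_mul_X_pow]
  rw [Finset.sum_ite_eq]
  split_ifs with hN
  · rfl
  · rw [h N (by simpa using hN)]

theorem sum_Qser_pow (t i : ℕ) : ∑ N ∈ Finset.range (i * (t + 1) + 1),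
    PowerSeries.C (PowerSeries.coeff N (Qser t ^ i)) * PowerSeries.X ^ N = Qser t ^ i :=
  sum_C_mul_X_pow _ fun N hN => coeff_Qser_pow_of_gt t (by omega)

/-- The shift turns each `N x_N` into `N x_N + τ^N` and fixes the coefficients of `Q^i`, which
depend on the `x_n + y_n` only; reassembling the powers of `τ` yields `Q^i`. -/
theorem Gpos_pcoef_mul (t : ℕ) {i : ℕ} (hi : 0 < i) (f : R) :
    Gpos (pcoef t i * f) = (PowerSeries.C (pcoef t i) + Qser t ^ i) * Gpos f := by
  rw [← sum_Qser_pow, pcoef_eq_wsum t i (Nat.lt_succ_self _), wsum_apply, Finset.sum_mul,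
    map_sum, ← Finset.sum_add_distrib, Finset.sum_mul]
  change GposL _ = _
  rw [map_sum]
  refine Finset.sum_congr rfl fun N _ => ?_
  change Gpos _ = _
  rcases Nat.eq_zero_or_pos N with rfl | hN
  · rw [coeff_Qser_pow_of_lt t hi, mul_zero, zero_mul, map_zero, zero_mul, add_zero, zero_mul]
    exact GposL.map_zero
  · rw [mul_comm (_ • _), mul_assoc, Gpos_const_mul (isConst_coeff_pow (isConst_coeff_Qser t) _ _),
      Gpos_x_mul hN, map_mul]
    ring

theorem Gneg_pcoef_mul (t : ℕ) {i : ℕ} (hi : 0 < i) (f : R) :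
    Gneg (pcoef t i * f) = (PowerSeries.C (pcoef t i) - Qser t ^ i) * Gneg f := by
  rw [← sum_Qser_pow, pcoef_eq_wsum t i (Nat.lt_succ_self _), wsum_apply, Finset.sum_mul,
    map_sum, ← Finset.sum_sub_distrib, Finset.sum_mul]
  change GnegL _ = _
  rw [map_sum]
  refine Finset.sum_congr rfl fun N _ => ?_
  change Gneg _ = _
  rcases Nat.eq_zero_or_pos N with rfl | hN
  · rw [coeff_Qser_pow_of_lt t hi, mul_zero, zero_mul, map_zero, zero_mul, sub_zero, zero_mul]
    exact GnegL.map_zero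
  · rw [mul_comm (_ • _), mul_assoc, Gneg_const_mul (isConst_coeff_pow (isConst_coeff_Qser t) _ _),
      Gneg_x_mul hN, map_mul]
    ring

theorem natCast_smul_Tcoef (t k : ℕ) : (k : ℂ) • Tcoef t k =
    ∑ q ∈ Finset.HasAntidiagonal.antidiagonal k,
      if q.1 = 0 then 0 else -(pcoef t q.1 * Tcoef t q.2) := by
  have h := congrArg (fun f => PowerSeries.coeff 0 (PowerSeries.coeff k f)) (eulerPS_Tser t)
  simp only [PowerSeries.coeff_mul k, eulerPS, Tser, Pser, PowerSeries.coeff_mk, smul_C,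
    map_sum] at h
  rw [PowerSeries.coeff_zero_C] at h
  rw [h]
  refine Finset.sum_congr rfl fun q _ => ?_
  split_ifs with h0 <;> simp [h0, PowerSeries.coeff_mk]

/-- The shift replaces `p_n` by `p_n - Q^n`, which multiplies `T(ε)` by `exp(∑ Q^n ε^n/n) = 1/(1 -
εQ)`. Both sides are shown to solve the same first-order equation in `ε`. -/
theorem mk_Gneg_Tcoef (t : ℕ) :
    (PowerSeries.mk fun k : ℕ => Gneg (Tcoef t k)) = Qgeom t * Tser t := by
  -- `V` is the logarithmic derivative `∑_{n≥1} (Q^n - p_n) ε^n` of the right-hand side.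
  refine eq_of_eulerPS_eq (V := Qgeom t - 1 - Pser t) (by simp [Qgeom, Pser]) ?_ ?_ ?_
  · ext1 k
    rw [PowerSeries.coeff_mul, eulerPS, PowerSeries.coeff_mk, PowerSeries.coeff_mk]
    change (k : ℂ) • GnegL _ = _
    rw [← map_smul, natCast_smul_Tcoef, map_sum]
    refine Finset.sum_congr rfl fun q _ => ?_
    by_cases h : q.1 = 0
    · rw [if_pos h, h, map_zero]
      simp [Qgeom, Pser]
    · rw [if_neg h, map_neg, PowerSeries.coeff_mk]
      change -Gneg _ = _
      rw [Gneg_pcoef_mul t (by omega)]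
      simp [Qgeom, Pser, h, PowerSeries.coeff_one]
      ring
  · rw [eulerPS_mul, eulerPS_Qgeom, eulerPS_Tser]; ring
  · simp [Qgeom, Tser, Tcoef_zero, Gneg_one]

theorem mk_Gpos_Tcoef (t : ℕ) : (PowerSeries.mk fun k : ℕ => Gpos (Tcoef t k)) =
    (1 - PowerSeries.X * PowerSeries.C (Qser t)) * Tser t := by
  refine eq_of_eulerPS_eq (V := -(Qgeom t - 1) - Pser t) (by simp [Qgeom, Pser]) ?_ ?_ ?_
  · ext1 k
    rw [PowerSeries.coeff_mul, eulerPS, PowerSeries.coeff_mk, PowerSeries.coeff_mk]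
    change (k : ℂ) • GposL _ = _
    rw [← map_smul, natCast_smul_Tcoef, map_sum]
    refine Finset.sum_congr rfl fun q _ => ?_
    by_cases h : q.1 = 0
    · rw [if_pos h, h, map_zero]
      simp [Qgeom, Pser]
    · rw [if_neg h, map_neg, PowerSeries.coeff_mk]
      change -Gpos _ = _
      rw [Gpos_pcoef_mul t (by omega)]
      simp [Qgeom, Pser, h, PowerSeries.coeff_one]
      ring
  · rw [eulerPS_mul, eulerPS_one_sub, eulerPS_Tser]; ring
  · simp [Tser, Tcoef_zero, Gpos_one]

/-! ### The derivation `∑ τ^a ∂/∂x_a` on `Q`. -/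

section MapD

variable {A : Type*} [CommRing A] [Algebra ℂ A]

/-- The coefficientwise action of a linear map on power series. -/
def mapD (E : A →ₗ[ℂ] A) : PowerSeries A →ₗ[ℂ] PowerSeries A where
  toFun f := PowerSeries.mk fun n => E (PowerSeries.coeff n f)
  map_add' f g := by ext1 N; simp
  map_smul' c f := by ext1 N; simp

theorem coeff_mapD (E : A →ₗ[ℂ] A) (f : PowerSeries A) (n : ℕ) :
    PowerSeries.coeff n (mapD E f) = E (PowerSeries.coeff n f) := by
  simp [mapD]

/-- The Leibniz rule. -/
def IsLeibniz (E : A →ₗ[ℂ] A) : Prop := ∀ a b, E (a * b) = a * E b + E a * b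

theorem IsLeibniz.mapD {E : A →ₗ[ℂ] A} (hE : IsLeibniz E) : IsLeibniz (mapD E) := by
  intro f g
  ext1 n
  rw [coeff_mapD, map_add, PowerSeries.coeff_mul, PowerSeries.coeff_mul, PowerSeries.coeff_mul,
    map_sum, ← Finset.sum_add_distrib]
  exact Finset.sum_congr rfl fun q _ => by rw [hE, coeff_mapD, coeff_mapD]

theorem IsLeibniz.map_one {E : A →ₗ[ℂ] A} (hE : IsLeibniz E) : E 1 = 0 := by
  simpa using hE 1 1

theorem IsLeibniz.map_pow_succ {E : A →ₗ[ℂ] A} (hE : IsLeibniz E) (f : A) (m : ℕ) :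
    E (f ^ (m + 1)) = ((m + 1 : ℕ) : ℂ) • (f ^ m * E f) := by
  induction m with
  | zero => simp
  | succ m ih =>
    rw [pow_succ, hE, ih, smul_mul_assoc, mul_right_comm, ← pow_succ]
    push_cast
    module

theorem mapD_eulerPS (E : A →ₗ[ℂ] A) (f : PowerSeries A) :
    mapD E (eulerPS f) = eulerPS (mapD E f) := by
  ext1 n
  simp [mapD, eulerPS]

theorem eulerPS_sub (f g : PowerSeries A) : eulerPS (f - g) = eulerPS f - eulerPS g := by
  ext1 n
  simp [eulerPS, smul_sub]

/-- If `z F' = V F` then a derivation acts on `F` as on `exp (∫ V / z)`. -/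
theorem mapD_eq_mul {E : A →ₗ[ℂ] A} (hE : IsLeibniz E) {F V W : PowerSeries A}
    (hV : PowerSeries.coeff 0 V = 0) (hF : eulerPS F = V * F) (hW : eulerPS W = mapD E V)
    (hW0 : PowerSeries.coeff 0 W = 0) (hF0 : E (PowerSeries.coeff 0 F) = 0) :
    mapD E F = W * F := by
  rw [← sub_eq_zero]
  refine eq_of_eulerPS_eq hV ?_ ?_ ?_
  · rw [eulerPS_sub, eulerPS_mul, ← mapD_eulerPS, hF, hE.mapD, hW]; ring
  · rw [mul_zero]; ext1 n; simp [eulerPS]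
  · rw [map_sub, coeff_mapD, hF0, PowerSeries.coeff_mul]
    simp [hW0]

end MapD

theorem isLeibniz_dx (n : ℕ) : IsLeibniz (dx n) := dx_mul n

/-- The derivation `∑_{a=1}^{M} τ^a ∂/∂x_a` on `ℂ[[x, y]][[τ]]`. -/
def dxSum (M : ℕ) : PowerSeries R →ₗ[ℂ] PowerSeries R :=
  ∑ a ∈ Finset.range M, LinearMap.mulLeft ℂ (PowerSeries.X ^ (a + 1)) ∘ₗ mapD (dx (a + 1))

theorem dxSum_apply (M : ℕ) (f : PowerSeries R) :
    dxSum M f = ∑ a ∈ Finset.range M, PowerSeries.X ^ (a + 1) * mapD (dx (a + 1)) f := by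
  simp [dxSum]

theorem isLeibniz_dxSum (M : ℕ) : IsLeibniz (dxSum M) := by
  intro f g
  simp only [dxSum_apply, Finset.mul_sum, Finset.sum_mul, ← Finset.sum_add_distrib]
  refine Finset.sum_congr rfl fun a _ => ?_
  rw [(isLeibniz_dx (a + 1)).mapD f g]
  ring

theorem coeff_dxSum (M : ℕ) (f : PowerSeries R) (N : ℕ) :
    PowerSeries.coeff N (dxSum M f) = ∑ a ∈ Finset.range M,
      if a + 1 ≤ N then dx (a + 1) (PowerSeries.coeff (N - (a + 1)) f) else 0 := by
  rw [dxSum_apply, map_sum]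
  refine Finset.sum_congr rfl fun a _ => ?_
  rw [PowerSeries.coeff_X_pow_mul', coeff_mapD]

/-- As `∂x_a` lowers the index of `S_m(x+y)` by `a`, it moves the coefficients of `Q` by `a` places.
The constant coefficient is exceptional because `Q` is cut off there. -/
theorem dx_coeff_Qser (t : ℕ) {a : ℕ} (ha : 0 < a) (N : ℕ) :
    dx a (PowerSeries.coeff N (Qser t)) =
      if N = 0 then 0 else PowerSeries.coeff (N + a) (Qser t) := by
  rw [coeff_Qser]
  split_ifs with h
  · rw [map_zero]
  · rw [dx_Spos ha, coeff_Qser, if_neg (by omega)]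
    congr 1
    push_cast; ring

theorem coeff_Qser_of_gt (t : ℕ) {N : ℕ} (h : t + 1 < N) : PowerSeries.coeff N (Qser t) = 0 := by
  rw [coeff_Qser, if_neg (by omega), Spos_of_neg (by omega)]

/-- Each `a` with `1 ≤ a < N` contributes one copy of the coefficient of `τ^N`, hence the factor `N
- 1`. -/
theorem dxSum_Qser {t M : ℕ} (h : t ≤ M) : dxSum M (Qser t) = eulerPS (Qser t) - Qser t := by
  ext1 N
  rw [coeff_dxSum, map_sub, eulerPS, PowerSeries.coeff_mk]
  rcases Nat.eq_zero_or_pos N with rfl | hN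
  · simp [coeff_Qser]
  have h1 : ∀ a ∈ Finset.range M,
      (if a + 1 ≤ N then dx (a + 1) (PowerSeries.coeff (N - (a + 1)) (Qser t)) else 0) =
      if a ∈ Finset.range (N - 1) then PowerSeries.coeff N (Qser t) else 0 := by
    intro a _
    simp only [Finset.mem_range]
    by_cases h2 : a + 1 ≤ N
    · rw [if_pos h2, dx_coeff_Qser t (Nat.succ_pos a)]
      by_cases h3 : a < N - 1
      · rw [if_neg (by omega), if_pos h3, Nat.sub_add_cancel h2]
      · rw [if_pos (by omega), if_neg h3]
    · rw [if_neg h2, if_neg (by omega)]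
  rw [Finset.sum_congr rfl h1]
  by_cases hNt : t + 1 < N
  · simp [coeff_Qser_of_gt t hNt]
  rw [Finset.sum_ite_mem, Finset.inter_eq_right.2 (Finset.range_mono (by omega)),
    Finset.sum_const, Finset.card_range, ← Nat.cast_smul_eq_nsmul ℂ, Nat.cast_sub hN]
  push_cast
  module

theorem wsum_smul (M : ℕ) (c : ℂ) (f : PowerSeries R) : wsum M (c • f) = c • wsum M f := by
  rw [wsum_apply, wsum_apply, Finset.smul_sum]
  exact Finset.sum_congr rfl fun N _ => by rw [PowerSeries.coeff_smul, mul_smul_comm]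

/-- `wsum` with coefficients in `ℂ[[x, y]][[τ]]`. -/
def wsumτ (M : ℕ) : PowerSeries (PowerSeries R) →ₗ[PowerSeries R] PowerSeries R :=
  ∑ N ∈ Finset.range M, 
    LinearMap.mulLeft (PowerSeries R) (PowerSeries.C ((N : ℂ) • x N)) ∘ₗ PowerSeries.coeff N

theorem wsumτ_apply (M : ℕ) (f : PowerSeries (PowerSeries R)) :
    wsumτ M f = ∑ N ∈ Finset.range M, PowerSeries.C ((N : ℂ) • x N) * PowerSeries.coeff N f := by
  simp [wsumτ]

theorem wsumτ_map_C (M : ℕ) (f : PowerSeries R) :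
    wsumτ M (PowerSeries.map PowerSeries.C f) = PowerSeries.C (wsum M f) := by
  rw [wsumτ_apply, wsum_apply, map_sum]
  exact Finset.sum_congr rfl fun N _ => by rw [PowerSeries.coeff_map, map_mul]

theorem wsumτ_C_mul (M : ℕ) (c : PowerSeries R) (f : PowerSeries (PowerSeries R)) :
    wsumτ M (PowerSeries.C c * f) = c * wsumτ M f := by
  rw [wsumτ_apply, wsumτ_apply, Finset.mul_sum]
  exact Finset.sum_congr rfl fun N _ => by rw [PowerSeries.coeff_C_mul]; ring

/-! ### Divided differences and the annihilation of `T_k p^k` by the nonnegative modes. -/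

/-- The divided difference `(F(s) - F(τ)) / (s - τ)`. -/
def divDiff (F : PowerSeries R) : PowerSeries (PowerSeries R) :=
  PowerSeries.mk fun j => PowerSeries.mk fun i => PowerSeries.coeff (i + j + 1) F

theorem coeff_coeff_divDiff (F : PowerSeries R) (i j : ℕ) :
    PowerSeries.coeff i (PowerSeries.coeff j (divDiff F)) = PowerSeries.coeff (i + j + 1) F := by
  simp [divDiff]

theorem sub_mul_divDiff (F : PowerSeries R) :
    (PowerSeries.X - PowerSeries.C PowerSeries.X) * divDiff F =
      PowerSeries.map PowerSeries.C F - PowerSeries.C F := by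
  ext1 j
  ext1 i
  rw [sub_mul, map_sub, map_sub, map_sub, map_sub, PowerSeries.coeff_C_mul, PowerSeries.coeff_map,
    PowerSeries.coeff_C, PowerSeries.coeff_C]
  rcases j with _ | j <;> rcases i with _ | i
  · simp
  · have := coeff_coeff_divDiff F i 0
    rw [PowerSeries.coeff_zero_eq_constantCoeff_apply] at this
    simp [PowerSeries.coeff_succ_X_mul, this]
  · simp [PowerSeries.coeff_succ_X_mul, coeff_coeff_divDiff]
  · simp [PowerSeries.coeff_succ_X_mul, coeff_coeff_divDiff]
    rw [show i + (j + 1) + 1 = i + 1 + j + 1 by ring, sub_self]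

theorem divDiff_pow (F : PowerSeries R) (m : ℕ) :
    divDiff (F ^ m) = (∑ i ∈ Finset.range m, PowerSeries.map PowerSeries.C F ^ i *
      PowerSeries.C F ^ (m - 1 - i)) * divDiff F := by
  have hne : (PowerSeries.X - PowerSeries.C PowerSeries.X : PowerSeries (PowerSeries R)) ≠ 0 := by
    intro h
    have := congrArg (fun f => PowerSeries.coeff 0 (PowerSeries.coeff 1 f)) h
    simp at this
  refine mul_left_cancel₀ hne ?_
  rw [sub_mul_divDiff, mul_left_comm, sub_mul_divDiff, Commute.geom_sum₂_mul (Commute.all _ _),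
    map_pow, map_pow]

/-- The series `∑_{a=1}^{M} τ^a (∂/∂x_a Q)(s)`. -/
def dQser (t M : ℕ) : PowerSeries (PowerSeries R) :=
  ∑ a ∈ Finset.range M, PowerSeries.C (PowerSeries.X ^ (a + 1)) *
    PowerSeries.map PowerSeries.C (mapD (dx (a + 1)) (Qser t))

/-- The coefficient of `s^N τ^i` in `s (Q(s) - Q(τ))/(s - τ)` is the coefficient of index `N + i` of
`Q`. By `dx_coeff_Qser` this is a derivative for `i > 0`, and `Q(s)` itself for `i = 0`. -/
theorem X_mul_divDiff_Qser {t M : ℕ} (h : t ≤ M) :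
    PowerSeries.X * divDiff (Qser t) = PowerSeries.map PowerSeries.C (Qser t) + dQser t M := by
  ext1 N
  ext1 i
  rw [map_add, map_add, dQser, map_sum, map_sum, PowerSeries.coeff_map, PowerSeries.coeff_C]
  have h1 : ∀ a ∈ Finset.range M, PowerSeries.coeff i (PowerSeries.coeff N
      (PowerSeries.C (PowerSeries.X ^ (a + 1)) *
        PowerSeries.map PowerSeries.C (mapD (dx (a + 1)) (Qser t)))) =
      if i = a + 1 then if N = 0 then 0 else PowerSeries.coeff (N + i) (Qser t) else 0 := by
    intro a _
    rw [PowerSeries.coeff_C_mul, PowerSeries.coeff_map, mul_comm, PowerSeries.coeff_C_mul,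
      PowerSeries.coeff_X_pow, coeff_mapD, dx_coeff_Qser t (Nat.succ_pos a)]
    by_cases h2 : i = a + 1
    · subst h2; simp
    · simp [h2]
  rw [Finset.sum_congr rfl h1]
  rcases N with _ | N
  · simp [coeff_Qser]
  rw [PowerSeries.coeff_succ_X_mul, coeff_coeff_divDiff]
  rcases i with _ | i
  · simp
  · simp only [Nat.succ_ne_zero, if_false, add_left_inj, Finset.sum_ite_eq, Finset.mem_range]
    rw [show i + 1 + N + 1 = N + 1 + (i + 1) by ring]
    split_ifs with hi
    · simp
    · rw [coeff_Qser_of_gt t (by omega)]; simp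

theorem dx_wsum {a M : ℕ} (ha : 0 < a) (haM : a < M) (F : PowerSeries R) :
    dx a (wsum M F) = wsum M (mapD (dx a) F) + (a : ℂ) • PowerSeries.coeff a F := by
  have : (a : ℂ) • PowerSeries.coeff a F = ∑ N ∈ Finset.range M,
      if a = N then (N : ℂ) • PowerSeries.coeff N F else 0 := by
    rw [Finset.sum_ite_eq, if_pos (Finset.mem_range.2 haM)]
  rw [wsum_apply, wsum_apply, map_sum, this, ← Finset.sum_add_distrib]
  refine Finset.sum_congr rfl fun N _ => ?_
  rw [dx_mul, coeff_mapD, map_smul]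
  congr 1
  rcases Nat.eq_zero_or_pos N with rfl | hN
  · simp
  · rw [dx_x ha hN]
    by_cases h : a = N
    · simp [h]
    · simp [h, Ne.symm h]

/-- The Leibniz rule on `∑ N x_N F_N`: differentiating the variables produces `τ F'`,
differentiating the coefficients produces the second summand. -/
theorem dxSum_C_wsum {M : ℕ} {F : PowerSeries R} (hF0 : PowerSeries.coeff 0 F = 0)
    (hF : ∀ N, M < N → PowerSeries.coeff N F = 0) :
    dxSum M (PowerSeries.C (wsum (M + 1) F)) = eulerPS F + wsumτ (M + 1) (∑ a ∈ Finset.range M,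
      PowerSeries.C (PowerSeries.X ^ (a + 1)) *
        PowerSeries.map PowerSeries.C (mapD (dx (a + 1)) F)) := by
  have hC (E : R →ₗ[ℂ] R) (r : R) : mapD E (PowerSeries.C r) = PowerSeries.C (E r) := by
    ext1 N
    rw [coeff_mapD, PowerSeries.coeff_C, PowerSeries.coeff_C]
    split_ifs <;> simp
  have hE : eulerPS F = ∑ a ∈ Finset.range M, PowerSeries.X ^ (a + 1) *
      PowerSeries.C (((a + 1 : ℕ) : ℂ) • PowerSeries.coeff (a + 1) F) := by
    rw [← sum_C_mul_X_pow (eulerPS F) (M := M + 1), Finset.sum_range_succ']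
    · simp only [eulerPS, PowerSeries.coeff_mk]
      rw [hF0, smul_zero, map_zero, zero_mul, add_zero]
      exact Finset.sum_congr rfl fun a _ => mul_comm _ _
    · intro N hN
      rw [eulerPS, PowerSeries.coeff_mk, hF N (by omega), smul_zero]
  rw [dxSum_apply, map_sum, hE, ← Finset.sum_add_distrib]
  refine Finset.sum_congr rfl fun a ha => ?_
  rw [Finset.mem_range] at ha
  rw [hC, dx_wsum (Nat.succ_pos a) (by omega), wsumτ_C_mul, wsumτ_map_C, map_add]
  ring

/-- `(1/i) ∑_{a=1}^{M} τ^a ∂p_i/∂x_a`. -/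
def deltaP (t M i : ℕ) : PowerSeries R := (i : ℂ)⁻¹ • dxSum M (PowerSeries.C (pcoef t i))

theorem eulerPS_pow_succ' {A : Type*} [CommRing A] [Algebra ℂ A] (f : PowerSeries A) (j : ℕ) :
    eulerPS (f ^ (j + 1)) = ((j + 1 : ℕ) : ℂ) • (eulerPS f * f ^ j) :=
  eulerPS_pow_succ (Commute.all _ _) j

theorem deltaP_succ {t M i : ℕ} (h : (i + 1) * (t + 1) ≤ M) :
    deltaP t M (i + 1) = eulerPS (Qser t) * Qser t ^ i +
      wsumτ (M + 1) (PowerSeries.map PowerSeries.C (Qser t ^ i) * dQser t M) := by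
  have hne : ((i + 1 : ℕ) : ℂ) ≠ 0 := by exact_mod_cast Nat.succ_ne_zero i
  rw [deltaP, inv_smul_eq_iff₀ hne, pcoef_eq_wsum t (i + 1) (Nat.lt_succ_of_le h),
    dxSum_C_wsum (coeff_Qser_pow_of_lt t (Nat.succ_pos i))
      fun N hN => coeff_Qser_pow_of_gt t (lt_of_le_of_lt h hN), eulerPS_pow_succ', smul_add]
  congr 1
  rw [dQser, Finset.mul_sum, map_sum, map_sum, Finset.smul_sum]
  refine Finset.sum_congr rfl fun a _ => ?_
  rw [wsumτ_C_mul, wsumτ_map_C, (isLeibniz_dx (a + 1)).mapD.map_pow_succ, mul_left_comm,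
    wsumτ_C_mul, ← map_mul, wsumτ_map_C, wsum_smul, ← smul_C, mul_smul_comm]

/-- The action on a power of `Qser t` of the modes `≥ 0` of the field
`(∑_{r ∈ ℤ} α_r z^{-r-1}) exp (-∑_{n > 0} (∂x_n - ∂y_n) z^{-n} / n)`. -/
theorem bracket_Qser_pow {t M m : ℕ} (h : m * (t + 1) ≤ M) (htM : t ≤ M) :
    dxSum M (Qser t ^ m) + (m : ℂ) • Qser t ^ m +
      wsumτ (M + 1) (PowerSeries.X * divDiff (Qser t ^ m)) =
    ∑ i ∈ Finset.range m, Qser t ^ (m - 1 - i) *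
      (PowerSeries.C (pcoef t (i + 1)) + deltaP t M (i + 1)) := by
  rcases m with _ | m
  · have h0 : divDiff 1 = 0 := by simpa using divDiff_pow (Qser t) 0
    simp [(isLeibniz_dxSum M).map_one, h0]
  rw [divDiff_pow, mul_left_comm, X_mul_divDiff_Qser htM, (isLeibniz_dxSum M).map_pow_succ,
    dxSum_Qser htM, Finset.sum_mul, map_sum]
  have h1 : ∀ i ∈ Finset.range (m + 1), Qser t ^ (m + 1 - 1 - i) *
      (PowerSeries.C (pcoef t (i + 1)) + deltaP t M (i + 1)) =
      eulerPS (Qser t) * Qser t ^ m + wsumτ (M + 1) (PowerSeries.map PowerSeries.C (Qser t) ^ i *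
        PowerSeries.C (Qser t) ^ (m + 1 - 1 - i) *
          (PowerSeries.map PowerSeries.C (Qser t) + dQser t M)) := by
    intro i hi
    rw [Finset.mem_range] at hi
    have hi' : (i + 1) * (t + 1) ≤ M := le_trans (Nat.mul_le_mul_right _ hi) h
    have hw : wsumτ (M + 1) (PowerSeries.map PowerSeries.C (Qser t) ^ i *
        (PowerSeries.map PowerSeries.C (Qser t) + dQser t M)) =
        PowerSeries.C (pcoef t (i + 1)) +
          wsumτ (M + 1) (PowerSeries.map PowerSeries.C (Qser t ^ i) * dQser t M) := by
      rw [mul_add, map_add, ← map_pow, ← map_mul, ← pow_succ, wsumτ_map_C,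
        ← pcoef_eq_wsum t (i + 1) (Nat.lt_succ_of_le hi')]
    rw [deltaP_succ hi', mul_comm (PowerSeries.map PowerSeries.C (Qser t) ^ i), mul_assoc,
      ← map_pow, wsumτ_C_mul, hw]
    have e : Qser t ^ m = Qser t ^ (m + 1 - 1 - i) * Qser t ^ i := by
      rw [← pow_add]; congr 1; omega
    rw [e, map_pow]; ring
  -- The `-Q` in `dxSum_Qser` contributes minus the exponent times the power of `Q`, which the
  -- charge term cancels exactly.
  rw [Finset.sum_congr rfl h1, Finset.sum_add_distrib, Finset.sum_const, Finset.card_range,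
    ← Nat.cast_smul_eq_nsmul ℂ, mul_sub, ← pow_succ, smul_sub, mul_comm (Qser t ^ m)]
  abel

theorem divDiff_mul_C (F : PowerSeries R) (c : R) :
    divDiff (F * PowerSeries.C c) = divDiff F * PowerSeries.C (PowerSeries.C c) := by
  ext1 j
  ext1 i
  simp [coeff_coeff_divDiff, PowerSeries.coeff_mul_C]

theorem divDiff_sum {ι : Type*} (s : Finset ι) (F : ι → PowerSeries R) :
    divDiff (∑ i ∈ s, F i) = ∑ i ∈ s, divDiff (F i) := by
  ext1 j
  ext1 i
  simp [coeff_coeff_divDiff]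

theorem Gneg_Tcoef (t k : ℕ) : Gneg (Tcoef t k) = ∑ q ∈ Finset.HasAntidiagonal.antidiagonal k,
    Qser t ^ q.1 * PowerSeries.C (Tcoef t q.2) := by
  have := congrArg (PowerSeries.coeff k) (mk_Gneg_Tcoef t)
  rw [PowerSeries.coeff_mul, PowerSeries.coeff_mk] at this
  rw [this]
  exact Finset.sum_congr rfl fun q _ => by simp [Qgeom, Tser]

/-- A derivation acts on the exponential `T(ε)` through its exponent, which is sent to `-∑ deltaP_i
ε^i`. -/
theorem dxSum_C_Tcoef (t M j : ℕ) : dxSum M (PowerSeries.C (Tcoef t j)) =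
    -PowerSeries.coeff j ((PowerSeries.mk fun i => deltaP t M i) * Tser t) := by
  have := mapD_eq_mul (isLeibniz_dxSum M) (F := Tser t) (V := -Pser t)
    (W := -PowerSeries.mk fun i => deltaP t M i) (by simp [Pser]) (eulerPS_Tser t) ?_ ?_ ?_
  · have h := congrArg (PowerSeries.coeff j) this
    rw [coeff_mapD, Tser, PowerSeries.coeff_mk, neg_mul, map_neg] at h
    exact h
  · ext1 i
    rw [coeff_mapD]
    simp only [eulerPS, Pser, PowerSeries.coeff_mk, map_neg, smul_neg]
    split_ifs with h
    · simp [h]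
    · rw [deltaP, smul_smul, mul_inv_cancel₀ (by exact_mod_cast h), one_smul]
  · simp [deltaP]
  · have := (isLeibniz_dxSum M).map_one
    simpa [Tser, Tcoef_zero] using this

/-- The modes `≥ 0` of
`(∑_{r ∈ ℤ} α_r z^{-r-1}) exp (-∑_{n > 0} (∂x_n - ∂y_n) z^{-n} / n)` kill `Tcoef t k p^k`. -/
theorem bracket_Gneg_Tcoef {t M k : ℕ} (h : k * (t + 1) ≤ M) (htM : t ≤ M) :
    dxSum M (Gneg (Tcoef t k)) + (k : ℂ) • Gneg (Tcoef t k) +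
      wsumτ (M + 1) (PowerSeries.X * divDiff (Gneg (Tcoef t k))) = 0 := by
  set V : PowerSeries (PowerSeries R) := Pser t + PowerSeries.mk fun i => deltaP t M i with hV
  have hV0 : PowerSeries.coeff 0 V = 0 := by simp [hV, Pser, deltaP]
  have hVs (i : ℕ) : PowerSeries.coeff (i + 1) V =
      PowerSeries.C (pcoef t (i + 1)) + deltaP t M (i + 1) := by simp [hV, Pser]
  have hterm : ∀ q ∈ Finset.HasAntidiagonal.antidiagonal k,
      dxSum M (Qser t ^ q.1 * PowerSeries.C (Tcoef t q.2)) +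
      (k : ℂ) • (Qser t ^ q.1 * PowerSeries.C (Tcoef t q.2)) +
      wsumτ (M + 1) (PowerSeries.X * divDiff (Qser t ^ q.1 * PowerSeries.C (Tcoef t q.2))) =
      PowerSeries.coeff q.1 (V * Qgeom t) * PowerSeries.coeff q.2 (Tser t) -
        PowerSeries.coeff q.1 (Qgeom t) * PowerSeries.coeff q.2 (V * Tser t) := by
    -- The charge `k` splits as `q.1 + q.2`. The first part completes the bracket on the power of
    -- `Q`; the second acts on `T` as the Euler operator, giving `-Pser * Tser`. Hence the same
    -- factor `V` appears on `Qgeom` and, with opposite sign, on `Tser`, and the total cancels.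
    intro q hq
    have hq := Finset.HasAntidiagonal.mem_antidiagonal.1 hq
    have hb := bracket_Qser_pow (t := t) (M := M) (m := q.1)
      (le_trans (Nat.mul_le_mul_right _ (by omega)) h) htM
    have hVQ : PowerSeries.coeff q.1 (V * Qgeom t) = ∑ i ∈ Finset.range q.1,
        Qser t ^ (q.1 - 1 - i) * (PowerSeries.C (pcoef t (i + 1)) + deltaP t M (i + 1)) := by
      rw [PowerSeries.coeff_mul, Finset.Nat.sum_antidiagonal_eq_sum_range_succ_mk,
        Finset.sum_range_succ', hV0, zero_mul, add_zero]
      refine Finset.sum_congr rfl fun i _ => ?_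
      rw [hVs, Qgeom, PowerSeries.coeff_mk, mul_comm, Nat.sub_sub, add_comm 1 i]
    rw [hVQ, ← hb, isLeibniz_dxSum, dxSum_C_Tcoef, divDiff_mul_C, ← mul_assoc, mul_comm _
      (PowerSeries.C (PowerSeries.C _)), wsumτ_C_mul]
    have hVT : PowerSeries.coeff q.2 (V * Tser t) = PowerSeries.coeff q.2 (Pser t * Tser t) +
        PowerSeries.coeff q.2 ((PowerSeries.mk fun i => deltaP t M i) * Tser t) := by
      rw [hV, add_mul, map_add]
    have hT : PowerSeries.coeff q.2 (Pser t * Tser t) =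
        -((q.2 : ℂ) • PowerSeries.C (Tcoef t q.2)) := by
      have := congrArg (PowerSeries.coeff q.2) (eulerPS_Tser t)
      rw [neg_mul, map_neg, eulerPS, PowerSeries.coeff_mk, Tser, PowerSeries.coeff_mk] at this
      rw [this, neg_neg, Tser]
    have hk : (k : ℂ) = q.1 + q.2 := by rw [← hq]; push_cast; rfl
    rw [hVT, hT, hk, add_smul]
    simp only [Qgeom, PowerSeries.coeff_mk]
    rw [show PowerSeries.coeff q.2 (Tser t) = PowerSeries.C (Tcoef t q.2) from
      PowerSeries.coeff_mk _ _, ← mul_smul_comm (q.2 : ℂ), ← smul_mul_assoc]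
    ring
  rw [Gneg_Tcoef, divDiff_sum, Finset.mul_sum, map_sum, map_sum, Finset.smul_sum,
    ← Finset.sum_add_distrib, ← Finset.sum_add_distrib, Finset.sum_congr rfl hterm,
    Finset.sum_sub_distrib, ← PowerSeries.coeff_mul, ← PowerSeries.coeff_mul, sub_eq_zero]
  congr 1
  ring

/-! ### The action of `φ*_{-t}` on `T_k p^k`. -/

theorem DnegZ_Tcoef_eq_coeff (t k j : ℕ) :
    DnegZ j (Tcoef t k) = PowerSeries.coeff j (Gneg (Tcoef t k)) := by
  rw [Gneg, PowerSeries.coeff_mk]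

theorem DnegZ_Tcoef_eq_zero (t k : ℕ) {j : ℕ} (h : k * (t + 1) < j) :
    DnegZ j (Tcoef t k) = 0 := by
  refine ((isHomZ_Tcoef t k).DnegZ j).eq_zero ?_
  have : ((k * (t + 1) : ℕ) : ℤ) < j := by exact_mod_cast h
  push_cast at this
  linarith

theorem sum_heis_DnegZ_Tcoef {t M k ρ : ℕ} (h : k * (t + 1) ≤ M) (htM : t ≤ M) (hρ : ρ ≤ M) :
    ∑ j ∈ Finset.range (ρ + 1 + M), heis k ((ρ : ℤ) - j) (DnegZ j (Tcoef t k)) = 0 := by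
  have hb := congrArg (PowerSeries.coeff ρ) (bracket_Gneg_Tcoef h htM)
  rw [map_add, map_add, map_zero, coeff_dxSum, PowerSeries.coeff_smul, wsumτ_apply, map_sum,
    Finset.sum_range_succ' _ M] at hb
  simp only [PowerSeries.coeff_C_mul, PowerSeries.coeff_succ_X_mul, coeff_coeff_divDiff,
    ← DnegZ_Tcoef_eq_coeff, PowerSeries.coeff_zero_X_mul, map_zero, mul_zero, add_zero] at hb
  -- The ranges `j < ρ`, `j = ρ` and `j > ρ` correspond to the derivatives, the charge and the
  -- multiplications, which are the three summands of the bracket.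
  rw [Finset.sum_range_add, Finset.sum_range_succ, ← hb]
  congr 1
  · congr 1
    · rw [← Finset.sum_subset (Finset.range_mono hρ), ← Finset.sum_range_reflect]
      · refine Finset.sum_congr rfl fun a ha => ?_
        rw [Finset.mem_range] at ha
        rw [if_pos (by omega), heis, if_pos (by omega), Nat.sub_sub, add_comm 1 a]
        congr 2
        omega
      · intro a _ ha
        rw [Finset.mem_range] at ha
        rw [if_neg (by omega)]
    · rw [sub_self, heis, if_neg (lt_irrefl 0), if_neg (lt_irrefl 0), Int.cast_natCast]
  · refine Finset.sum_congr rfl fun a _ => ?_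
    rw [heis, if_neg (by omega), if_pos (by omega), smul_mul_assoc,
      show ρ + a + 1 = ρ + 1 + a by ring,
      show -((ρ : ℤ) - ((ρ + 1 + a : ℕ) : ℤ)) = ((a + 1 : ℕ) : ℤ) by push_cast; ring,
      Int.cast_natCast, Int.toNat_natCast]

theorem sum_pcoef_mul_Tcoef (t k : ℕ) :
    ∑ q ∈ Finset.HasAntidiagonal.antidiagonal k, pcoef t (q.1 + 1) * Tcoef t q.2 =
      -(((k + 1 : ℕ) : ℂ) • Tcoef t (k + 1 : ℕ)) := by
  rw [natCast_smul_Tcoef, Finset.Nat.sum_antidiagonal_succ]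
  simp

theorem wsum_C_mul_X_pow {M n : ℕ} (h : n < M) (c : R) :
    wsum M (PowerSeries.C c * PowerSeries.X ^ n) = c * ((n : ℂ) • x n) := by
  rw [wsum_apply, Finset.sum_eq_single n]
  · rw [PowerSeries.coeff_C_mul_X_pow, if_pos rfl, mul_comm]
  · intro b _ hb
    rw [PowerSeries.coeff_C_mul_X_pow, if_neg hb, mul_zero]
  · intro hn
    exact absurd (Finset.mem_range.2 h) hn

theorem Qser_eq_sum (t : ℕ) : Qser t = ∑ m ∈ Finset.range (t + 1),
    PowerSeries.C (Spos m) * PowerSeries.X ^ (t + 1 - m) := by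
  ext1 N
  rw [Qser, Qpoly, Polynomial.coeff_coe, Polynomial.finsetSum_coeff, map_sum]
  exact Finset.sum_congr rfl fun m _ => by
    rw [Polynomial.coeff_C_mul_X_pow, PowerSeries.coeff_C_mul_X_pow]

/-- `φ*_{-t}` maps `T_k p^k` to `-(k+1) T_{k+1} p^{k+1}`. -/
theorem phiStarR_Tcoef (t k : ℕ) :
    phiStarR k (-(t : ℤ)) (Tcoef t k) = -(((k + 1 : ℕ) : ℂ) • Tcoef t (k + 1 : ℕ)) := by
  set W : ℕ := k * (t + 1) with hW
  set M : ℕ := W + t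
  set N : ℕ := W + M
  have hT : IsHomZ (Tcoef t k) W := by
    have := isHomZ_Tcoef t k
    rwa [show (k : ℤ) * (t + 1) = W by rw [hW]; push_cast; ring] at this
  have hzero : ∀ ρ : ℤ, ∀ j : ℕ, ρ < -(t + 1) ∨ (W : ℤ) < ρ →
      Spos (ρ + 1 + t) * heis k (ρ - j) (DnegZ j (Tcoef t k)) = 0 := by
    rintro ρ j (h | h)
    · rw [Spos_of_neg (by omega), zero_mul]
    · rw [((hT.DnegZ j).heis k (ρ - j)).eq_zero (by omega), mul_zero]
  -- Substituting `ρ = r + j` makes the factor `Spos` independent of `j`, so the sum over `j`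
  -- becomes a mode of the Heisenberg field times the shift.
  have hshift : ∀ j ∈ Finset.range (N + 1), ∑ r ∈ Finset.Icc (-((N + M + 2 : ℕ) : ℤ)) (N + M + 2 : ℕ),
      Spos (r + 1 + j - -(t : ℤ)) * heis k r (DnegZ j (Tcoef t k)) =
      ∑ᶠ ρ : ℤ, Spos (ρ + 1 + t) * heis k (ρ - j) (DnegZ j (Tcoef t k)) := by
    intro j hj
    rw [Finset.mem_range] at hj
    rw [← finsum_comp_equiv (Equiv.addRight (j : ℤ)), finsum_eq_sum_of_support_subset
      (s := Finset.Icc (-((N + M + 2 : ℕ) : ℤ)) (N + M + 2 : ℕ))]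
    · refine Finset.sum_congr rfl fun r _ => ?_
      rw [Equiv.coe_addRight, add_sub_cancel_right,
        show r + 1 + (j : ℤ) - -(t : ℤ) = r + j + 1 + t by ring]
    · intro r hr
      by_contra hs
      rw [Finset.coe_Icc, Set.mem_Icc] at hs
      exact hr (hzero (r + j) j (by omega))
  rw [phiStarR_eq_sum hT k (-(t : ℤ)) (N := N) (M := N + M + 2) (by omega) (by omega) (by omega),
    Finset.sum_congr rfl hshift, ← finsum_sum_comm]
  swap
  · intro j _
    refine (Set.finite_Icc (-(t + 1 : ℤ)) W).subset fun ρ hρ => ?_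
    by_contra hs
    rw [Set.mem_Icc] at hs
    exact hρ (hzero ρ j (by omega))
  -- Only `-(t+1) ≤ ρ ≤ -1` survives: below, `Spos` vanishes; from `0` up to the weight `W` the mode
  -- kills `T_k p^k`; above, the weight is negative.
  rw [← sum_range_eq_finsum _ (-(t + 1 : ℤ)) t]
  swap
  · rintro ρ h
    by_cases h2 : ρ < -(t + 1) ∨ (W : ℤ) < ρ
    · exact Finset.sum_eq_zero fun j _ => hzero ρ j h2
    · lift ρ to ℕ using (by omega)
      rw [← Finset.mul_sum, ← Finset.sum_subset (Finset.range_mono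
        (show ρ + 1 + M ≤ N + 1 by omega)), sum_heis_DnegZ_Tcoef (by omega) (by omega)
        (by omega), mul_zero]
      intro j _ hj
      rw [Finset.mem_range] at hj
      rw [DnegZ_Tcoef_eq_zero t k (by omega), heis_zero_right]
  have hG : Gneg (Tcoef t k) = ∑ j ∈ Finset.range (N + 1),
      PowerSeries.C (DnegZ j (Tcoef t k)) * PowerSeries.X ^ j := by
    rw [← sum_C_mul_X_pow (Gneg (Tcoef t k)) (M := N + 1)]
    · simp only [← DnegZ_Tcoef_eq_coeff]
    · intro j hj
      rw [← DnegZ_Tcoef_eq_coeff]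
      exact DnegZ_Tcoef_eq_zero t k (by omega)
  -- For `ρ < 0` every index `ρ - j` is negative, so only multiplications by the `x_n` occur and the
  -- sum is the functional `τ^n ↦ n x_n` on `Q` times the shifted `T_k`.
  have h1 : wsum (N + t + 2) (Qser t * Gneg (Tcoef t k)) =
      ∑ m ∈ Finset.range (t + 1), ∑ j ∈ Finset.range (N + 1),
        Spos m * heis k (m + -(t + 1 : ℤ) - j) (DnegZ j (Tcoef t k)) := by
    rw [hG, Qser_eq_sum, Finset.sum_mul, map_sum]
    refine Finset.sum_congr rfl fun m hm => ?_
    rw [Finset.mul_sum, map_sum]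
    refine Finset.sum_congr rfl fun j hj => ?_
    rw [Finset.mem_range] at hm hj
    rw [mul_mul_mul_comm, ← map_mul, ← pow_add, wsum_C_mul_X_pow (by omega), heis,
      if_neg (by omega), if_pos (by omega),
      show -((m : ℤ) + -(t + 1 : ℤ) - j) = ((t + 1 - m + j : ℕ) : ℤ) by
        push_cast [Nat.cast_sub (show m ≤ t + 1 by omega)]; ring,
      Int.cast_natCast, Int.toNat_natCast, mul_assoc, ← smul_mul_assoc, mul_comm (_ • _)]
  have h2 : wsum (N + t + 2) (Qser t * Gneg (Tcoef t k)) =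
      -(((k + 1 : ℕ) : ℂ) • Tcoef t (k + 1 : ℕ)) := by
    rw [Gneg_Tcoef, Finset.mul_sum, map_sum, ← sum_pcoef_mul_Tcoef]
    refine Finset.sum_congr rfl fun q hq => ?_
    have hq := Finset.HasAntidiagonal.mem_antidiagonal.1 hq
    have hle : (q.1 + 1) * (t + 1) < N + t + 2 := by
      have : q.1 * (t + 1) ≤ k * (t + 1) := Nat.mul_le_mul_right _ (by omega)
      rw [add_mul, one_mul]
      omega
    rw [← mul_assoc, ← pow_succ', mul_comm _ (PowerSeries.C _), ← PowerSeries.smul_eq_C_mul,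
      map_smul, ← pcoef_eq_wsum t (q.1 + 1) hle, smul_eq_mul, mul_comm]
  rw [← h2, h1]
  refine Finset.sum_congr rfl fun m _ => Finset.sum_congr rfl fun j _ => ?_
  congr 2
  ring

/-! ### The action of `φ_{-s}` on `T(ε)` and the powers of `φ_{-s} φ*_{-t}`. -/

/-- The generating series of the `Tcoef t k`. -/
def TserR (t : ℕ) : PowerSeries R := PowerSeries.mk fun k : ℕ => Tcoef t k

/-- The series `S_{s-1}(-x-y) - A_{s,t} ε`. -/
def phiSer (s t : ℕ) : PowerSeries R :=
  PowerSeries.C (Sneg ((s : ℤ) - 1)) - PowerSeries.X * PowerSeries.C (Acoef s t)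

theorem Gpos_Tcoef (t k : ℕ) : Gpos (Tcoef t k) =
    PowerSeries.C (Tcoef t k) - Qser t * PowerSeries.C (Tcoef t ((k : ℤ) - 1)) := by
  have := congrArg (PowerSeries.coeff k) (mk_Gpos_Tcoef t)
  rw [PowerSeries.coeff_mk] at this
  rw [this, sub_mul, one_mul, map_sub, mul_assoc]
  cases k with
  | zero => simp [Tser, Tcoef, schur_of_neg]
  | succ k =>
    rw [PowerSeries.coeff_succ_X_mul, PowerSeries.coeff_C_mul]
    simp [Tser]

/-- Pairing `τ^j` with `S_{s-1+j}(-x-y)` sends `1` to `S_{s-1}(-x-y)` and `Q` to `A_{s,t}`, hence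
`(1 - εQ) T(ε)` to `(S_{s-1} - εA) T(ε)`. -/
theorem sum_Sneg_mul_DposZ_Tcoef (s t k : ℕ) {N : ℕ} (hN : t + 1 ≤ N) :
    ∑ j ∈ Finset.range (N + 1), Sneg (j - -(s : ℤ) - 1) * DposZ j (Tcoef t k) =
      PowerSeries.coeff k (phiSer s t * TserR t) := by
  have hR : PowerSeries.coeff k (phiSer s t * TserR t) =
      Sneg ((s : ℤ) - 1) * Tcoef t k - Acoef s t * Tcoef t ((k : ℤ) - 1) := by
    rw [phiSer, sub_mul, map_sub, PowerSeries.coeff_C_mul, mul_assoc, TserR]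
    cases k with
    | zero => simp [Tcoef, schur_of_neg]
    | succ k => rw [PowerSeries.coeff_succ_X_mul, PowerSeries.coeff_C_mul]; simp
  have hA : ∑ j ∈ Finset.range (N + 1), Sneg (j - -(s : ℤ) - 1) * PowerSeries.coeff j (Qser t) =
      Acoef s t := by
    simp only [Qser_eq_sum, map_sum, PowerSeries.coeff_C_mul_X_pow, Finset.mul_sum, Acoef]
    rw [Finset.sum_comm]
    refine Finset.sum_congr rfl fun m hm => ?_
    rw [Finset.mem_range] at hm
    simp only [mul_ite, mul_zero]
    rw [Finset.sum_ite_eq' (Finset.range (N + 1)), if_pos (Finset.mem_range.2 (by omega)), mul_comm]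
    congr 2
    push_cast [Nat.cast_sub (show m ≤ t + 1 by omega)]
    ring
  have hD (j : ℕ) : DposZ j (Tcoef t k) = PowerSeries.coeff j (Gpos (Tcoef t k)) := by
    rw [Gpos, PowerSeries.coeff_mk]
  simp only [hD, Gpos_Tcoef, map_sub, mul_sub, Finset.sum_sub_distrib, PowerSeries.coeff_mul_C]
  rw [hR, ← hA, Finset.sum_mul]
  congr 1
  · rw [Finset.sum_range_succ', Finset.sum_eq_zero]
    · simp
    · intro j _
      rw [PowerSeries.coeff_C, if_neg (Nat.succ_ne_zero j), mul_zero]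
  · exact Finset.sum_congr rfl fun j _ => by ring

theorem IsHomZ.phiR_iterate {f : R} {d : ℤ} (hf : IsHomZ f d) (i : ℤ) (n : ℕ) :
    IsHomZ ((ChargedBosons.phiR i)^[n] f) (d + n * (-i - 1)) := by
  induction n with
  | zero => simpa using hf
  | succ n ih =>
    rw [Function.iterate_succ_apply']
    convert ih.phiR i using 1
    push_cast; ring

theorem isConst_coeff_phiSer (s t N : ℕ) : IsConst (PowerSeries.coeff N (phiSer s t)) := by
  have hA : IsConst (Acoef s t) := IsConst.sum fun m _ => (isConst_Spos _).mul (isConst_Sneg _)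
  intro n
  rw [phiSer, map_sub, PowerSeries.coeff_C, PowerSeries.coeff_mul_C, PowerSeries.coeff_X, map_sub]
  split_ifs <;> simp [isConst_Sneg _ n, hA n]

/-- The multiplier `phiSer` has coefficients fixed by the shift, so each further application of
`φ_{-s}` multiplies by it once more. -/
theorem phiR_iterate_Tcoef (s t k n : ℕ) : (phiR (-(s : ℤ)))^[n] (Tcoef t k) =
    PowerSeries.coeff k (phiSer s t ^ n * TserR t) := by
  induction n with
  | zero => simp [TserR]
  | succ n ih =>
    have hh := (isHomZ_Tcoef t k).phiR_iterate (-(s : ℤ)) n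
    rw [Function.iterate_succ_apply']
    set d : ℤ := (k : ℤ) * (t + 1) + n * (- -(s : ℤ) - 1)
    rw [phiR_eq_sum hh _ (N := d.toNat + t + 1) (by omega), ih, PowerSeries.coeff_mul]
    simp only [map_sum, Finset.mul_sum]
    rw [Finset.sum_comm, pow_succ, mul_assoc, PowerSeries.coeff_mul]
    refine Finset.sum_congr rfl fun q _ => ?_
    rw [← sum_Sneg_mul_DposZ_Tcoef s t q.2 (N := d.toNat + t + 1) (by omega), Finset.mul_sum]
    refine Finset.sum_congr rfl fun j _ => ?_
    rw [DposZ_mul_left (isConst_coeff_pow (isConst_coeff_phiSer s t) _ _), mul_left_comm]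
    congr 3
    simp [TserR]

theorem phiStarR_phiR_iterate {f : R} {d : ℤ} (hf : IsHomZ f d) (l : ℤ) {i j : ℤ} (hij : i + j < 0)
    (n : ℕ) : phiStarR l j ((phiR i)^[n] f) = (phiR i)^[n] (phiStarR (l + n) j f) := by
  induction n generalizing f d with
  | zero => simp
  | succ n ih =>
    rw [Function.iterate_succ_apply, ih (hf.phiR i), Function.iterate_succ_apply,
      phiR_phiStarR hf _ hij]
    congr 2
    push_cast; ring

theorem formalSum_smul {ι : Type*} (c : ℂ) (F : ι → R) :
    formalSum (fun i => c • F i) = c • formalSum F := by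
  ext m
  rw [map_smul, coeff_formalSum, coeff_formalSum, smul_finsum]
  rfl

theorem phiR_smul (i : ℤ) (c : ℂ) (f : R) : phiR i (c • f) = c • phiR i f := by
  simp only [phiR, map_smul, mul_smul_comm, formalSum_smul]

theorem heis_smul (l r : ℤ) (c : ℂ) (f : R) : heis l r (c • f) = c • heis l r f := by
  unfold heis
  split_ifs
  · rw [map_smul]
  · rw [mul_smul_comm, smul_comm]
  · rw [smul_comm]

theorem phiStarR_smul (l i : ℤ) (c : ℂ) (f : R) : phiStarR l i (c • f) = c • phiStarR l i f := by
  simp only [phiStarR, map_smul, heis_smul, mul_smul_comm, formalSum_smul]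

theorem phiR_iterate_smul (i : ℤ) (n : ℕ) (c : ℂ) (f : R) :
    (phiR i)^[n] (c • f) = c • (phiR i)^[n] f := by
  induction n generalizing f with
  | zero => rfl
  | succ n ih => rw [Function.iterate_succ_apply, phiR_smul, ih, Function.iterate_succ_apply]

theorem iterate_apply_one (s t : ℕ) (hs : 1 ≤ s) (a : ℂ) (k : ℕ) :
    (fun v : B => a • phi (-(s : ℤ)) (phiStar (-(t : ℤ)) v))^[k] (ofR 1) =
      ofR (((k ! : ℂ) * (-a) ^ k) • PowerSeries.coeff k (phiSer s t ^ k * TserR t)) := by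
  rw [← phiR_iterate_Tcoef]
  induction k with
  | zero => simp [Tcoef_zero]
  | succ k ih =>
    rw [Function.iterate_succ_apply', ih]
    simp only [ofR]
    -- The state `φ_{-s}^k T_k` has charge `0`. Moving `φ*_{-t}` inward past each `φ_{-s}` raises
    -- its charge to `k`, where `phiStarR_Tcoef` applies.
    rw [phiStar_single, phi_single, phiStarR_smul, phiR_smul,
      phiStarR_phiR_iterate (isHomZ_Tcoef t k) 0 (by omega), zero_add (k : ℤ),
      phiStarR_Tcoef,
      ← Function.iterate_succ_apply' (phiR _), ← neg_smul, phiR_iterate_smul, zero_add, sub_self,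
      ← Pi.single_smul, smul_smul, smul_smul]
    congr 2
    rw [Nat.factorial_succ]
    push_cast
    ring

/-! ### The weight filtration and congruences for infinite sums and exponentials. -/

theorem wt_zero : wt 0 = 0 := by simp [wt]

/-- The ideal of the power series all of whose monomials have weight at least `W`. -/
def wtIdeal (W : ℕ) : Ideal R where
  carrier := {f | ∀ m, wt m < W → MvPowerSeries.coeff m f = 0}
  add_mem' hf hg m hm := by rw [map_add, hf m hm, hg m hm, add_zero]
  zero_mem' _ _ := map_zero _
  smul_mem' c f hf m hm := by
    classical
    rw [smul_eq_mul, MvPowerSeries.coeff_mul]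
    refine Finset.sum_eq_zero fun q hq => ?_
    rw [← Finset.HasAntidiagonal.mem_antidiagonal.1 hq, wt_add] at hm
    rw [hf q.2 (by omega), mul_zero]

theorem IsHomZ.mem_wtIdeal {f : R} {d : ℤ} (hf : IsHomZ f d) {W : ℕ} (h : (W : ℤ) ≤ d) :
    f ∈ wtIdeal W := by
  intro m hm
  by_contra hh
  have := hf m hh
  omega

theorem wtIdeal_mono {W W' : ℕ} (h : W ≤ W') : wtIdeal W' ≤ wtIdeal W :=
  fun _ hf m hm => hf m (lt_of_lt_of_le hm h)

theorem mem_wtIdeal_zero (f : R) : f ∈ wtIdeal 0 := fun _ hm => absurd hm (Nat.not_lt_zero _)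

theorem mul_mem_wtIdeal {f g : R} {a b : ℕ} (hf : f ∈ wtIdeal a) (hg : g ∈ wtIdeal b) :
    f * g ∈ wtIdeal (a + b) := by
  classical
  intro m hm
  rw [MvPowerSeries.coeff_mul]
  refine Finset.sum_eq_zero fun q hq => ?_
  rw [← Finset.HasAntidiagonal.mem_antidiagonal.1 hq, wt_add] at hm
  by_cases h : wt q.1 < a
  · rw [hf q.1 h, zero_mul]
  · rw [hg q.2 (by omega), mul_zero]

theorem pow_mem_wtIdeal {f : R} (hf : f ∈ wtIdeal 1) (n : ℕ) : f ^ n ∈ wtIdeal n := by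
  induction n with
  | zero => exact mem_wtIdeal_zero _
  | succ n ih => rw [pow_succ]; exact mul_mem_wtIdeal ih hf

theorem smul_mem_wtIdeal {f : R} {W : ℕ} (c : ℂ) (hf : f ∈ wtIdeal W) : c • f ∈ wtIdeal W :=
  fun m hm => by rw [map_smul, hf m hm, smul_zero]

theorem eq_of_forall_sub_mem_wtIdeal {f g : R} (h : ∀ W, f - g ∈ wtIdeal W) : f = g := by
  ext m
  rw [← sub_eq_zero, ← map_sub]
  exact h (wt m + 1) m (Nat.lt_succ_self _)

theorem constantCoeff_eq_zero {f : R} (hf : f ∈ wtIdeal 1) :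
    MvPowerSeries.constantCoeff f = 0 := by
  rw [← MvPowerSeries.coeff_zero_eq_constantCoeff_apply]
  exact hf 0 (by rw [wt_zero]; exact Nat.one_pos)

theorem locallyFinite_of_mem {F : ℕ → R} (hF : ∀ n, F n ∈ wtIdeal n) : LocallyFinite F := by
  intro m
  refine (Set.finite_le_nat (wt m)).subset fun n hn => ?_
  by_contra h
  exact hn (hF n m (not_le.1 h))

theorem formalSum_sub_sum_mem {F : ℕ → R} (hF : ∀ n, F n ∈ wtIdeal n) (W : ℕ) :
    formalSum F - ∑ n ∈ Finset.range W, F n ∈ wtIdeal W := by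
  intro m hm
  rw [map_sub, coeff_formalSum, map_sum, sub_eq_zero]
  refine finsum_eq_sum_of_support_subset _ fun n hn => ?_
  by_contra h
  rw [Finset.coe_range, Set.mem_Iio, not_lt] at h
  exact hn (hF n m (lt_of_lt_of_le hm h))

theorem expR_sub_sum_mem {h : R} (hh : h ∈ wtIdeal 1) (W : ℕ) :
    expR h - ∑ j ∈ Finset.range W, (j ! : ℂ)⁻¹ • h ^ j ∈ wtIdeal W := by
  intro m hm
  rw [expR, map_sub, PowerSeries.coeff_subst
    (PowerSeries.HasSubst.of_constantCoeff_zero (constantCoeff_eq_zero hh)), map_sum, sub_eq_zero]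
  rw [finsum_eq_sum_of_support_subset (s := Finset.range W)]
  · refine Finset.sum_congr rfl fun j _ => ?_
    rw [PowerSeries.coeff_exp, map_smul]
    simp
  · intro j hj
    by_contra h'
    rw [Finset.coe_range, Set.mem_Iio, not_lt] at h'
    refine hj ?_
    simp only [pow_mem_wtIdeal hh j m (lt_of_lt_of_le hm h'), smul_zero]

/-- The sum of the coefficients of index less than `W`. -/
def partialSum (W : ℕ) (f : PowerSeries R) : R := ∑ n ∈ Finset.range W, PowerSeries.coeff n f

theorem coeff_mul_mem {f g : PowerSeries R} (hf : ∀ n, PowerSeries.coeff n f ∈ wtIdeal n)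
    (hg : ∀ n, PowerSeries.coeff n g ∈ wtIdeal n) (n : ℕ) :
    PowerSeries.coeff n (f * g) ∈ wtIdeal n := by
  rw [PowerSeries.coeff_mul]
  refine Ideal.sum_mem _ fun q hq => ?_
  rw [← Finset.HasAntidiagonal.mem_antidiagonal.1 hq]
  exact mul_mem_wtIdeal (hf _) (hg _)

/-- Truncated evaluation at `ε = 1` is multiplicative up to weight `W`: the discarded products have
`i + j ≥ W`. -/
theorem partialSum_mul_sub_mem {f g : PowerSeries R}
    (hf : ∀ n, PowerSeries.coeff n f ∈ wtIdeal n) (hg : ∀ n, PowerSeries.coeff n g ∈ wtIdeal n)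
    (W : ℕ) : partialSum W (f * g) - partialSum W f * partialSum W g ∈ wtIdeal W := by
  have h1 : partialSum W (f * g) = ∑ i ∈ Finset.range W, ∑ j ∈ Finset.range (W - i),
      PowerSeries.coeff i f * PowerSeries.coeff j g := by
    rw [← Finset.sum_range_diag_flip W
      fun i j => PowerSeries.coeff i f * PowerSeries.coeff j g]
    refine Finset.sum_congr rfl fun n _ => ?_
    rw [PowerSeries.coeff_mul, Finset.Nat.sum_antidiagonal_eq_sum_range_succ_mk]
  rw [h1, partialSum, partialSum, Finset.sum_mul_sum, ← Finset.sum_sub_distrib]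
  refine Ideal.sum_mem _ fun i hi => ?_
  rw [Finset.mem_range] at hi
  rw [← neg_sub, neg_mem_iff, ← Finset.sum_sdiff_eq_sub (Finset.range_mono (Nat.sub_le _ _))]
  refine Ideal.sum_mem _ fun j hj => ?_
  rw [Finset.mem_sdiff, Finset.mem_range, Finset.mem_range] at hj
  exact wtIdeal_mono (by omega) (mul_mem_wtIdeal (hf i) (hg j))

theorem partialSum_pow_sub_mem {f : PowerSeries R}
    (hf : ∀ n, PowerSeries.coeff n f ∈ wtIdeal n) (W j : ℕ) :
    partialSum W (f ^ j) - partialSum W f ^ j ∈ wtIdeal W := by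
  have hpow : ∀ j n, PowerSeries.coeff n (f ^ j) ∈ wtIdeal n := by
    intro j
    induction j with
    | zero =>
      intro n
      rw [pow_zero, PowerSeries.coeff_one]
      split_ifs with h
      · rw [h]; exact mem_wtIdeal_zero _
      · exact Ideal.zero_mem _
    | succ j ih => rw [pow_succ]; exact coeff_mul_mem ih hf
  induction j with
  | zero =>
    rcases W with _ | W
    · exact mem_wtIdeal_zero _
    · simp [partialSum, PowerSeries.coeff_one]
  | succ j ih =>
    rw [pow_succ, pow_succ, ← sub_add_sub_cancel _ (partialSum W (f ^ j) * partialSum W f),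
      ← sub_mul]
    exact Ideal.add_mem _ (partialSum_mul_sub_mem (hpow j) hf W) (Ideal.mul_mem_right _ _ ih)

theorem schur_scale {A : Type*} [CommRing A] [Algebra ℂ A] (u : ℕ → A) (b : A) (k : ℕ) :
    schur (fun n => b ^ n * u n) k = b ^ k * schur u k := by
  have h : schurExp (fun n => b ^ n * u n) = PowerSeries.rescale b (schurExp u) := by
    ext1 n
    rw [PowerSeries.coeff_rescale, schurExp, schurExp, PowerSeries.coeff_mk, PowerSeries.coeff_mk]
    split_ifs <;> simp
  rw [schur_natCast _ le_rfl, schur_natCast _ le_rfl, h, Finset.mul_sum]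
  refine Finset.sum_congr rfl fun j _ => ?_
  rw [← map_pow, PowerSeries.coeff_rescale, mul_smul_comm]

theorem pow_sub_pow_mem (W : ℕ) {f g : R} (h : f - g ∈ wtIdeal W) (j : ℕ) :
    f ^ j - g ^ j ∈ wtIdeal W :=
  Ideal.mem_of_dvd _ (sub_dvd_pow_sub_pow f g j) h

/-- The exponential of a sum is the sum of the elementary Schur polynomials. -/
theorem expR_sub_sum_schur_mem {v : ℕ → R} (hv : ∀ n, v n ∈ wtIdeal n) (hv0 : v 0 = 0) {h : R}
    (hh : ∀ W, h - ∑ n ∈ Finset.range W, v n ∈ wtIdeal W) (W : ℕ) :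
    expR h - ∑ n ∈ Finset.range W, schur v n ∈ wtIdeal W := by
  have hV : ∀ n, PowerSeries.coeff n (schurExp v) = v n := fun n => by
    rw [schurExp, PowerSeries.coeff_mk]
    split_ifs with h0
    · rw [h0, hv0]
    · rfl
  have h1 : h ∈ wtIdeal 1 := by simpa [hv0] using hh 1
  have h2 : ∑ n ∈ Finset.range W, schur v n =
      ∑ j ∈ Finset.range (W + 1), (j ! : ℂ)⁻¹ • partialSum W (schurExp v ^ j) := by
    simp only [partialSum, Finset.smul_sum]
    rw [Finset.sum_comm]
    refine Finset.sum_congr rfl fun n hn => ?_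
    exact schur_natCast v (Finset.mem_range.1 hn).le
  rw [h2, ← sub_add_sub_cancel _ (∑ j ∈ Finset.range (W + 1), (j ! : ℂ)⁻¹ • h ^ j)]
  refine Ideal.add_mem _ (wtIdeal_mono (Nat.le_succ W) (expR_sub_sum_mem h1 (W + 1))) ?_
  rw [← Finset.sum_sub_distrib]
  refine Ideal.sum_mem _ fun j _ => ?_
  rw [← smul_sub]
  refine smul_mem_wtIdeal _ ?_
  rw [← sub_add_sub_cancel _ (partialSum W (schurExp v) ^ j)]
  refine Ideal.add_mem _ (pow_sub_pow_mem W ?_ j) ?_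
  · simpa only [partialSum, hV] using hh W
  · rw [← neg_sub]
    exact Ideal.neg_mem_iff _ |>.2
      (partialSum_pow_sub_mem (fun n => by rw [hV]; exact hv n) W j)

theorem one_sub_mul_sum_choose (c : R) (j M : ℕ) :
    (1 - c) * ∑ i ∈ Finset.range M, ((i + (j + 1)).choose (j + 1) : R) * c ^ i =
      ∑ i ∈ Finset.range M, ((i + j).choose j : R) * c ^ i - ((M + j).choose (j + 1) : R) * c ^ M := by
  induction M with
  | zero => simp
  | succ M ih =>
    rw [Finset.sum_range_succ, mul_add, ih, Finset.sum_range_succ,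
      show M + 1 + j = M + (j + 1) by ring]
    have : ((M + (j + 1)).choose (j + 1) : R) = (M + j).choose j + (M + j).choose (j + 1) := by
      rw [← add_assoc, Nat.choose_succ_succ]; push_cast; rfl
    rw [this]
    ring

/-- The negative binomial series of `(1 - c)^{-j-1}`, by induction on `j`; Pascal's rule supplies
the step, with a remainder divisible by `c^M`. -/
theorem pow_sub_sum_choose_mem {c Y : R} (hc : c ∈ wtIdeal 1) (hY : Y * (1 - c) = 1) (j M : ℕ) :
    Y ^ (j + 1) - ∑ i ∈ Finset.range M, ((i + j).choose j : R) * c ^ i ∈ wtIdeal M := by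
  induction j with
  | zero =>
    have h : Y ^ (0 + 1) - ∑ i ∈ Finset.range M, ((i + 0).choose 0 : R) * c ^ i = Y * c ^ M := by
      simp only [Nat.choose_zero_right, Nat.cast_one, one_mul]
      linear_combination (∑ i ∈ Finset.range M, c ^ i) * hY + Y * geom_sum_mul c M
    rw [h]
    exact Ideal.mul_mem_left _ _ (pow_mem_wtIdeal hc M)
  | succ j ih =>
    have h : Y ^ (j + 1 + 1) - ∑ i ∈ Finset.range M, ((i + (j + 1)).choose (j + 1) : R) * c ^ i =
        Y * (Y ^ (j + 1) - ∑ i ∈ Finset.range M, ((i + j).choose j : R) * c ^ i) +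
          Y * ((M + j).choose (j + 1) : R) * c ^ M := by
      linear_combination
        (∑ i ∈ Finset.range M, ((i + (j + 1)).choose (j + 1) : R) * c ^ i) * hY -
          Y * one_sub_mul_sum_choose c j M
    rw [h]
    exact Ideal.add_mem _ (Ideal.mul_mem_left _ _ ih)
      (Ideal.mul_mem_left _ _ (pow_mem_wtIdeal hc M))

/-! ### Summation of the exponential series. -/

theorem isHomZ_Acoef (s t : ℕ) : IsHomZ (Acoef s t) (s + t) := by
  refine IsHomZ.sum fun m _ => ?_
  convert (isHomZ_Spos m).mul (isHomZ_Sneg ((s : ℤ) + t - m)) using 1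
  ring

theorem smul_Acoef_mem {s : ℕ} (hs : 1 ≤ s) (t : ℕ) (a : ℂ) : a • Acoef s t ∈ wtIdeal 1 :=
  smul_mem_wtIdeal _ ((isHomZ_Acoef s t).mem_wtIdeal (by omega))

theorem constantCoeff_one_sub {s : ℕ} (hs : 1 ≤ s) (t : ℕ) (a : ℂ) :
    MvPowerSeries.constantCoeff (1 - a • Acoef s t) = 1 := by
  rw [map_sub, constantCoeff_eq_zero (smul_Acoef_mem hs t a), map_one, sub_zero]

theorem pcoef_mem (t n : ℕ) : pcoef t n ∈ wtIdeal n :=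
  (isHomZ_pcoef t n).mem_wtIdeal (by nlinarith)

theorem Tcoef_mem (t n : ℕ) : Tcoef t n ∈ wtIdeal n :=
  (isHomZ_Tcoef t n).mem_wtIdeal (by nlinarith)

/-- The terms of the exponent, indexed by `ℕ`. -/
def expoTermNat (a : ℂ) (s t n : ℕ) : R := ((n : ℂ)⁻¹ • pcoef t n) * wArg a s t ^ n

theorem expoTermNat_mem (a : ℂ) (s t n : ℕ) : expoTermNat a s t n ∈ wtIdeal n :=
  Ideal.mul_mem_right _ _ (smul_mem_wtIdeal _ (pcoef_mem t n))

theorem expoTermNat_zero (a : ℂ) (s t : ℕ) : expoTermNat a s t 0 = 0 := by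
  simp [expoTermNat]

theorem locallyFinite_expoTerm (a : ℂ) (s t : ℕ) : LocallyFinite (expoTerm a s t) := by
  intro m
  refine Set.Finite.of_finite_image (f := fun n : ℕ+ => (n : ℕ)) ?_ PNat.coe_injective.injOn
  refine (locallyFinite_of_mem (expoTermNat_mem a s t) m).subset ?_
  rintro _ ⟨n, hn, rfl⟩
  exact hn

theorem formalSum_expoTerm_sub_mem (a : ℂ) (s t W : ℕ) :
    formalSum (expoTerm a s t) - ∑ n ∈ Finset.range W, expoTermNat a s t n ∈ wtIdeal W := by
  have h : formalSum (expoTerm a s t) = formalSum fun n => expoTermNat a s t (n + 1) := by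
    ext m
    rw [coeff_formalSum, coeff_formalSum, ← finsum_comp_equiv Equiv.pnatEquivNat.symm]
    rfl
  rcases W with _ | W
  · exact mem_wtIdeal_zero _
  rw [h, Finset.sum_range_succ', expoTermNat_zero, add_zero]
  intro m hm
  rw [map_sub, coeff_formalSum, map_sum, sub_eq_zero]
  refine finsum_eq_sum_of_support_subset _ fun n hn => ?_
  by_contra h
  rw [Finset.coe_range, Set.mem_Iio, not_lt] at h
  exact hn (expoTermNat_mem a s t (n + 1) m (by omega))

/-- The exponential in the closed formula is `T(ε)` evaluated at `ε = wArg a s t`; rescaling the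
exponent extracts the powers of `wArg`. -/
theorem expR_sub_sum_Tcoef_mem (a : ℂ) (s t W : ℕ) :
    expR (-formalSum (expoTerm a s t)) -
      ∑ n ∈ Finset.range W, wArg a s t ^ n * Tcoef t n ∈ wtIdeal W := by
  have hv : ∀ n, -expoTermNat a s t n = wArg a s t ^ n * -((n : ℂ)⁻¹ • pcoef t n) := fun n => by
    rw [expoTermNat]; ring
  have := expR_sub_sum_schur_mem (v := fun n => -expoTermNat a s t n)
    (fun n => neg_mem (expoTermNat_mem a s t n)) (by simp [expoTermNat_zero])
    (h := -formalSum (expoTerm a s t)) (fun W => by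
      rw [Finset.sum_neg_distrib, ← neg_sub', neg_mem_iff]
      exact formalSum_expoTerm_sub_mem a s t W) W
  simp only [hv, schur_scale] at this
  exact this

/-- The terms of `exp (a φ_{-s} φ*_{-t}) · 1`. -/
def expTerm (a : ℂ) (s t k : ℕ) : R :=
  (-a) ^ k • PowerSeries.coeff k (phiSer s t ^ k * TserR t)

/-- The term is homogeneous of weight `k(t+1) + k(s-1) = k(s+t)`, which is at least `k` as `s ≥ 1`.
This gives the convergence. -/
theorem expTerm_mem (a : ℂ) {s : ℕ} (hs : 1 ≤ s) (t k : ℕ) : expTerm a s t k ∈ wtIdeal k := by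
  rw [expTerm, ← phiR_iterate_Tcoef]
  refine smul_mem_wtIdeal _ (((isHomZ_Tcoef t k).phiR_iterate _ k).mem_wtIdeal ?_)
  nlinarith

theorem coeff_C_add_X_mul_C_pow (c d : R) {k i : ℕ} (h : i ≤ k) :
    PowerSeries.coeff i ((PowerSeries.C d + PowerSeries.X * PowerSeries.C c) ^ k) =
      (k.choose i : R) * c ^ i * d ^ (k - i) := by
  rw [add_comm, add_pow, map_sum, Finset.sum_eq_single i]
  · rw [mul_pow, ← map_pow, ← map_pow, mul_assoc, mul_assoc, ← map_natCast PowerSeries.C,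
      ← map_mul, ← map_mul, PowerSeries.coeff_X_pow_mul', if_pos le_rfl, Nat.sub_self,
      PowerSeries.coeff_zero_C]
    ring
  · intro m _ hm
    rw [mul_pow, ← map_pow, ← map_pow, mul_assoc, mul_assoc, ← map_natCast PowerSeries.C,
      ← map_mul, ← map_mul, PowerSeries.coeff_X_pow_mul']
    split_ifs with hmi
    · rw [PowerSeries.coeff_C, if_neg (by omega)]
    · rfl
  · intro hi
    exact absurd (Finset.mem_range.2 (by omega)) hi

theorem expTerm_eq (a : ℂ) (s t k : ℕ) : expTerm a s t k = ∑ j ∈ Finset.range (k + 1),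
    ((k - j + j).choose j : R) * (a • Acoef s t) ^ (k - j) *
      ((-(a • Sneg ((s : ℤ) - 1))) ^ j * Tcoef t j) := by
  have h : (-a) ^ k • phiSer s t ^ k = (PowerSeries.C (-(a • Sneg ((s : ℤ) - 1))) +
      PowerSeries.X * PowerSeries.C (a • Acoef s t)) ^ k := by
    rw [← smul_pow, phiSer, ← smul_C, map_neg, ← smul_C, mul_smul_comm, smul_sub, neg_smul, neg_smul]
    ring
  rw [expTerm, ← PowerSeries.coeff_smul, ← smul_mul_assoc, h, mul_comm, PowerSeries.coeff_mul,
    Finset.Nat.sum_antidiagonal_eq_sum_range_succ_mk]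
  refine Finset.sum_congr rfl fun j hj => ?_
  rw [Finset.mem_range] at hj
  rw [coeff_C_add_X_mul_C_pow _ _ (Nat.sub_le k j), Nat.sub_sub_self (by omega),
    Nat.sub_add_cancel (by omega), Nat.choose_symm (by omega), TserR, PowerSeries.coeff_mk]
  ring

theorem formalSum_expTerm (a : ℂ) {s : ℕ} (hs : 1 ≤ s) (t : ℕ) :
    formalSum (expTerm a s t) =
      (1 - a • Acoef s t)⁻¹ * expR (-formalSum (expoTerm a s t)) := by
  set c := a • Acoef s t
  set Y := (1 - c)⁻¹ with hYdef
  set d := -(a • Sneg ((s : ℤ) - 1))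
  have hY : Y * (1 - c) = 1 := MvPowerSeries.inv_mul_cancel _ (by
    rw [constantCoeff_one_sub hs]; exact one_ne_zero)
  refine eq_of_forall_sub_mem_wtIdeal fun W => ?_
  have h1 := formalSum_sub_sum_mem (expTerm_mem a hs t) W
  have h2 := Ideal.mul_mem_left _ Y (expR_sub_sum_Tcoef_mem a s t W)
  have h3 : ∑ k ∈ Finset.range W, expTerm a s t k -
      Y * ∑ n ∈ Finset.range W, wArg a s t ^ n * Tcoef t n ∈ wtIdeal W := by
    have e : ∑ k ∈ Finset.range W, expTerm a s t k = ∑ j ∈ Finset.range W,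
        ∑ i ∈ Finset.range (W - j), ((i + j).choose j : R) * c ^ i * (d ^ j * Tcoef t j) := by
      rw [← Finset.sum_range_diag_flip W fun j i =>
        ((i + j).choose j : R) * c ^ i * (d ^ j * Tcoef t j)]
      exact Finset.sum_congr rfl fun k _ => expTerm_eq a s t k
    rw [e, Finset.mul_sum, ← Finset.sum_sub_distrib]
    refine Ideal.sum_mem _ fun j hj => ?_
    rw [Finset.mem_range] at hj
    have hw : wArg a s t = d * Y := rfl
    rw [← Finset.sum_mul, hw, mul_pow]
    -- `T_j` already has weight at least `j`, so the binomial series is needed only up to weight `W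
    -- - j`. The exponent `j + 1` of `Y` comes from the prefactor together with the `j` denominators
    -- in `wArg^j`.
    have hj' := mul_mem_wtIdeal (pow_sub_sum_choose_mem (smul_Acoef_mem hs t a) hY j (W - j))
      (Ideal.mul_mem_left _ (d ^ j) (Tcoef_mem t j))
    rw [Nat.sub_add_cancel hj.le] at hj'
    convert neg_mem hj' using 1
    ring
  have := Ideal.sub_mem _ (Ideal.add_mem _ h1 h3) h2
  convert this using 1
  ring

theorem hasFormalSum_ofR {ι : Type*} {F : ι → R} (hF : LocallyFinite F) :
    HasFormalSum (fun i => ofR (F i)) (ofR (formalSum F)) := by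
  intro l
  rcases eq_or_ne l 0 with rfl | hl
  · simpa [ofR] using hF
  · have h0 : ∀ f : R, ofR f l = 0 := fun f => by
      rw [ofR, Pi.single_eq_of_ne hl]
    simp only [h0]
    exact ⟨fun m => by simp, formalSum_eq_sum ∅ (by simp)⟩

end ChargedBosons
end

/-- The series `exp (a φ_{-s} φ*_{-t}) · 1 = ∑_k (a φ_{-s} φ*_{-t})^k · 1 / k!` converges formally in
`ℂ[[x, y; p, p⁻¹]]`, and its sum is the closed formula.  The first three conjuncts say that
every expression on the right-hand side of the formula is well defined. -/
theorem corollary3p7 (s t : ℕ) (hs : 1 ≤ s) (a : ℂ) :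
    IsUnit (1 - a • ChargedBosons.Acoef s t) ∧
    ChargedBosons.LocallyFinite (ChargedBosons.expoTerm a s t) ∧
    MvPowerSeries.constantCoeff
      (ChargedBosons.formalSum (ChargedBosons.expoTerm a s t)) = 0 ∧
    ChargedBosons.HasFormalSum
      (fun k : ℕ => ((k ! : ℂ)⁻¹) •
        (fun v : ChargedBosons.B =>
          a • ChargedBosons.phi (-(s : ℤ)) (ChargedBosons.phiStar (-(t : ℤ)) v))^[k]
            (ChargedBosons.ofR 1))
      (ChargedBosons.ofR
        ((1 - a • ChargedBosons.Acoef s t)⁻¹ *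
          ChargedBosons.expR (-ChargedBosons.formalSum (ChargedBosons.expoTerm a s t)))) := by
  open ChargedBosons in
  refine ⟨?_, locallyFinite_expoTerm a s t, ?_, ?_⟩
  · rw [MvPowerSeries.isUnit_iff_constantCoeff, constantCoeff_one_sub hs]
    exact isUnit_one
  · refine constantCoeff_eq_zero ?_
    simpa [expoTermNat_zero] using formalSum_expoTerm_sub_mem a s t 1
  · rw [← formalSum_expTerm a hs]
    -- The `k!` accumulated by the iterated action of `φ*_{-t}` cancels the denominator of the
    -- exponential series.
    convert hasFormalSum_ofR (locallyFinite_of_mem (expTerm_mem a hs t)) using 2 with k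
    rw [iterate_apply_one s t hs, ofR, ofR, ← Pi.single_smul, smul_smul, expTerm,
      inv_mul_cancel_left₀ (by exact_mod_cast Nat.factorial_ne_zero k)]
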